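/- **Conventions.** A *map* is a rooted planar map: a connected graph (loops and multiple edges allowed) embedded in the oriented sphere with simply connected faces, up to orientation-preserving homeomorphism, together with a *root*, a dangling half-edge attached in a corner of a vertex (the root-vertex). A (plane) *tree* is a map with one face; size means number of edges. The *tour* of a tree follows its border counterclockwise, starting from the root: after a half-edge one turns to the next half-edge counterclockwise around the vertex. A *tree-rooted map* $M_T$ is a map $M$ with a spanning tree $T$. Let $n$ be its size. *The word $\Xi(M_T)$.* Make the tour of $T$, following the edges of $T$ and crossing the other edges, and write $a$ (resp. $\bar a$) when an edge of $T$ is followed for the first (resp. second) time, and $b$ (resp. $\bar b$) when an edge not in $T$ is crossed for the first (resp. second) time. *The map $\Phi$.* Orient the edges of $T$ from the root to the leaves, and each other edge so that its head precedes its tail during the tour of $T$; the root counts as a head. This gives the oriented map $\vec M^T$. Replace each vertex $v$ by as many vertices as there are heads incident to $v$, each tail at $v$ staying adjacent only to the first head encountered counterclockwise around $v$ from that tail (cyclic orders are kept). The result is $\varphi_0(\vec M^T)$. Number its vertices in their order of appearance around it; $\varphi_1(\vec M^T)$ is the relation "coming from the same vertex of $M$" on these $n+1$ vertices. $\Phi(M_T)=(\varphi_0(\vec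 M^T),\varphi_1(\vec M^T))$. *The map $\lambda_0'$.* Let $\tau$ be the tree with no edge, and let $\sigma(T_1,T_2)$ be obtained from $T_2$ by joining its root-vertex by a new edge to the root-vertex of $T_1$, which becomes its last son. Define sequences $\lambda_0(w)$ of letters $u,v$ and trees by $\lambda_0(\epsilon)=u\tau v$; $\lambda_0(wa)$: replace the last $u$ of $\lambda_0(w)$ by $u\tau v$; $\lambda_0(wb)$: replace the first $v$ by $u\tau v$; $\lambda_0(w\bar a)$: replace $T_1vT_2$ around the first $v$ by $\sigma(T_1,T_2)$; $\lambda_0(w\bar b)$: replace $T_1uT_2$ around the last $u$ by $\sigma(T_1,T_2)$. If $\lambda_0(w)=uTv$, then $\lambda_0'(w)=T$. *The map $\lambda_1'$.* A binary tree consists of nodes, each with a left and a right son, and leaves; its size is its number of nodes, and leaves are ordered from left to right. Let $B_1$ be one node with two active leaves. $\lambda_1(\epsilon)=B_1$; $\lambda_1(wa)$: replace the last active left leaf of $\lambda_1(w)$ by $B_1$; $\lambda_1(wb)$: replace the first active right leaf by $B_1$; $\lambda_1(w\bar a)$: inactivate the first active right leaf; $\lambda_1(w\bar b)$: inactivate the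 last active left leaf. $\lambda_1'(w)$ is $\lambda_1(w)$ with all leaves inactive. Put $\Lambda(w)=(\lambda_0'(w),\lambda_1'(w))$. *The map $\Theta$.* For a binary tree $B$, $\theta(B)$ is the plane tree obtained by contracting every edge of $B$ that is not branching, an edge being branching if one of its ends is a right son and the other is a left son or the root-vertex. For a non-crossing partition $P$ of $\{1,\dots,m\}$, draw the points on a horizontal line and the parts as disjoint cells in the lower half-plane; $\Upsilon(P)$ is the dual plane tree: one vertex in each part and in each component of the complement of the parts, one edge for each side of a cell (a part with $k$ points has $k$ sides), rooted at the vertex of the infinite component, the root following counterclockwise the edge to the part of the point $1$. $\Theta(B)=\Upsilon^{-1}(\theta(B))$. **Theorem.** Let $M_T$ be a tree-rooted map of size $n$ and $w=\Xi(M_T)$. Then $\lambda_0(w)$ has the form $uTv$, and $$\varphi_0(\vec M^T)=\lambda_0'(w).$$ Moreover $\lambda_1'(w)$ has size $n+1$, $\varphi_1(\vec M^T)$ is a non-crossing partition, and $$\varphi_1(\vec M^T)=\Theta(\lambda_1'(w)).$$ For every $m\ge 0$ the map $\Theta$ is a well-defined bijection from binary trees with $m$ nodes to non-crossing partitions of $\{1,\dots,m\}$.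 Thus $\Phi=(\mathrm{id}\times\Theta)\circ\Lambda\circ\Xi$, i.e. $\Phi$ is isomorphic to $\Lambda$ via $\Xi$. -/

import Mathlib

open Classical in
/-- First return of a permutation `σ` to the classes of `c`: `x` is sent to the first of
`σ x, σ² x, …` that has the same class as `x`. -/
noncomputable def firstReturnFun {H ι : Type*} (σ : Equiv.Perm H) (c : H → ι) (x : H) : H :=
  (σ ^ sInf {k : ℕ | 0 < k ∧ c ((σ ^ k) x) = c x}) x

theorem firstReturn_spec {H ι : Type*} [Finite H] (σ : Equiv.Perm H) (c : H → ι) (x : H) :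
    0 < sInf {k : ℕ | 0 < k ∧ c ((σ ^ k) x) = c x} ∧
      c (firstReturnFun σ c x) = c x := by
  have hne : {k : ℕ | 0 < k ∧ c ((σ ^ k) x) = c x}.Nonempty :=
    ⟨orderOf σ, orderOf_pos σ, by simp [pow_orderOf_eq_one]⟩
  exact Nat.sInf_mem hne

theorem firstReturnFun_injective {H ι : Type*} [Finite H] (σ : Equiv.Perm H) (c : H → ι) :
    Function.Injective (firstReturnFun σ c) := by
  have key : ∀ x y : H, firstReturnFun σ c x = firstReturnFun σ c y →
      sInf {k : ℕ | 0 < k ∧ c ((σ ^ k) x) = c x} ≤ sInf {k : ℕ | 0 < k ∧ c ((σ ^ k) y) = c y} →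
      x = y := by
    intro x y hxy hle
    obtain ⟨hx0, hx⟩ := firstReturn_spec σ c x
    obtain ⟨hy0, hy⟩ := firstReturn_spec σ c y
    have hc : c x = c y := by rw [← hx, ← hy, hxy]
    unfold firstReturnFun at hxy
    obtain ⟨d, hd⟩ := Nat.exists_eq_add_of_le hle
    rw [hd, pow_add, Equiv.Perm.mul_apply] at hxy
    have hx' : x = (σ ^ d) y := (σ ^ _).injective hxy
    rcases Nat.eq_zero_or_pos d with h0 | hpos
    · simpa [h0] using hx'
    · have : sInf {k : ℕ | 0 < k ∧ c ((σ ^ k) y) = c y} ≤ d :=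
        Nat.sInf_le ⟨hpos, by rw [← hx', hc]⟩
      omega
  intro x y hxy
  rcases le_total (sInf {k : ℕ | 0 < k ∧ c ((σ ^ k) x) = c x})
    (sInf {k : ℕ | 0 < k ∧ c ((σ ^ k) y) = c y}) with h | h
  · exact key x y hxy h
  · exact (key y x hxy.symm h).symm

/-- First return as a permutation. Each cycle of `σ` is cut into one cycle for every class of `c`
that it meets, and the cyclic order inside each class is kept. -/
noncomputable def firstReturn {H ι : Type*} [Finite H] (σ : Equiv.Perm H) (c : H → ι) :
    Equiv.Perm H :=
  Equiv.ofBijective (firstReturnFun σ c)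
    (Finite.injective_iff_bijective.mp (firstReturnFun_injective σ c))

/-! ### Embedded graphs given by their half-edges -/

/-- A graph drawn on an oriented surface, given by its set `H` of half-edges. `σ h` is the next
half-edge in counterclockwise direction around the vertex incident to `h`; the vertices are the
cycles of `σ`. `α` exchanges the two halves of every edge and fixes the half-edges that do not
belong to an edge (dangling half-edges). The root is a dangling half-edge. -/
structure HalfEdgeMap (H : Type*) where
  σ : Equiv.Perm H
  α : H → H
  α_invol : Function.Involutive α
  root : H
  α_root : α root = root

namespace HalfEdgeMap

variable {H : Type*}

/-- Following a border: arriving along `h`, go to the other end of its edge (if it has one) and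
turn to the next half-edge in counterclockwise direction. The cycles of `face` are the faces. -/
def face (M : HalfEdgeMap H) : Equiv.Perm H := M.α_invol.toPerm.trans M.σ

/-- Two half-edges lie in the same connected component. -/
def Reach (M : HalfEdgeMap H) (x y : H) : Prop :=
  Relation.EqvGen (fun x y => y = M.σ x ∨ y = M.α x) x y

def Connected (M : HalfEdgeMap H) : Prop := ∀ x y : H, M.Reach x y

noncomputable def vertexCount (M : HalfEdgeMap H) : ℕ :=
  Nat.card (Quotient (Equiv.Perm.SameCycle.setoid M.σ))

noncomputable def faceCount (M : HalfEdgeMap H) : ℕ :=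
  Nat.card (Quotient (Equiv.Perm.SameCycle.setoid M.face))

/-- The size: the number of edges. -/
noncomputable def size (M : HalfEdgeMap H) : ℕ := Nat.card {h : H // M.α h ≠ h} / 2

/-- The surface is the sphere: Euler's formula. -/
def IsPlanar (M : HalfEdgeMap H) : Prop :=
  M.Connected ∧ M.vertexCount + M.faceCount = M.size + 2

/-- A rooted planar map: connected, drawn on the sphere, and the root is the only half-edge that
does not belong to an edge. -/
def IsRootedMap (M : HalfEdgeMap H) : Prop :=
  M.IsPlanar ∧ ∀ h, M.α h = h → h = M.root

open Classical in
/-- The drawing in which only the edges contained in `T` are kept as edges; the half-edges of the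
other edges remain as dangling half-edges at their vertices. -/
noncomputable def restrict (M : HalfEdgeMap H) (T : Set H) : HalfEdgeMap H where
  σ := M.σ
  α := fun h => if h ∈ T ∧ M.α h ∈ T then M.α h else h
  α_invol := by
    intro h
    by_cases hh : h ∈ T ∧ M.α h ∈ T
    · simp [hh, M.α_invol h]
    · simp [hh]
  root := M.root
  α_root := by simp [M.α_root]

/-- `T` is the set of half-edges of a spanning tree: the submap with all the vertices of `M` and
with the edges in `T` is a tree, that is, a planar map with a single face. -/
def IsSpanningTree (M : HalfEdgeMap H) (T : Set H) : Prop :=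
  M.root ∉ T ∧ (∀ h ∈ T, M.α h ∈ T) ∧ (M.restrict T).IsPlanar ∧ (M.restrict T).faceCount = 1

/-- The moment at which `h` is encountered when the border is followed from the root. -/
noncomputable def time (M : HalfEdgeMap H) (h : H) : ℕ := sInf {k : ℕ | (M.face ^ k) M.root = h}

/-- The half-edge `x` is encountered before `y` during the tour of the tree `T`. During the tour
the edges of `T` are followed and the other edges are crossed. -/
def Precedes (M : HalfEdgeMap H) (T : Set H) (x y : H) : Prop :=
  (M.restrict T).time x < (M.restrict T).time y

/-! ### Orientation and vertex explosion -/

/-- The oriented map of a tree-rooted map, given by its set of heads. The root is a head. Edges of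
the tree point away from the root: the head is the half that is separated from the root when the
edge is removed from the tree. For the other edges the head precedes the tail around the tree. -/
def heads (M : HalfEdgeMap H) (T : Set H) : Set H :=
  {h | h = M.root ∨
    (h ∈ T ∧ ¬ (M.restrict (T \ {h, M.α h})).Reach M.root h) ∨
    (h ∉ T ∧ M.Precedes T h (M.α h))}

/-- The first head encountered in counterclockwise direction starting from `x` (`x` itself if `x` is
a head). -/
noncomputable def firstHead (M : HalfEdgeMap H) (O : Set H) (x : H) : H :=
  (M.σ ^ sInf {k : ℕ | (M.σ ^ k) x ∈ O}) x

/-- The vertex explosion (the map `φ₀`) of a map oriented by the set `O` of heads: every vertex is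
replaced by one vertex for each head incident to it, and every tail stays adjacent exactly to the
first head encountered in counterclockwise direction. -/
noncomputable def phi0 [Finite H] (M : HalfEdgeMap H) (O : Set H) : HalfEdgeMap H where
  σ := firstReturn M.σ (M.firstHead O)
  α := M.α
  α_invol := M.α_invol
  root := M.root
  α_root := M.α_root

open Classical in
/-- The vertices in their order of appearance when the border is followed from the root. Each
vertex is represented by the half-edge at which the border is when the vertex first appears. -/
noncomputable def appearance (M : HalfEdgeMap H) : List H :=
  ((List.range (Nat.card H)).filter
    (fun k => ∀ j < k, ¬ M.σ.SameCycle ((M.face ^ j) M.root) ((M.face ^ k) M.root))).map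
    (fun k => (M.face ^ k) M.root)

/-- The equivalence relation `φ₁` on the vertices of `φ₀`, numbered by their order of appearance
around `φ₀`: two vertices are equivalent if they come from the same vertex of `M`. -/
noncomputable def phi1 [Finite H] (M : HalfEdgeMap H) (O : Set H) : Setoid (Fin (M.size + 1)) :=
  (Equiv.Perm.SameCycle.setoid M.σ).comap
    (fun i => (M.phi0 O).appearance.getD i.val M.root)

end HalfEdgeMap

/-! ### The Walsh–Lehman word -/

/-- The alphabet `a, ā, b, b̄`. -/
inductive Letter
  | a | abar | b | bbar
  deriving DecidableEq

open Classical in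
/-- The parenthesis-shuffle `Ξ(M_T)`: make the tour of `T`, and write `a` (resp. `ā`) when an edge
of `T` is followed for the first (resp. second) time, `b` (resp. `b̄`) when an edge not in `T` is
crossed for the first (resp. second) time. -/
noncomputable def HalfEdgeMap.shuffle {H : Type*} (M : HalfEdgeMap H) (T : Set H) : List Letter :=
  (List.range (2 * M.size)).map fun k =>
    let h := ((M.restrict T).face ^ (k + 1)) M.root
    if h ∈ T then (if M.Precedes T h (M.α h) then Letter.a else Letter.abar)
    else (if M.Precedes T h (M.α h) then Letter.b else Letter.bbar)

/-! ### Plane trees -/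

/-- Planted plane trees; the subtrees of the sons of the root-vertex are listed in their order of
appearance around the tree. -/
inductive PlaneTree
  | node (sons : List PlaneTree)

/-- Seen from its head `h` (the root, or the half-edge towards the father), a vertex and its
descendants form the plane tree `t`: the half-edges that follow `h` counterclockwise lead to
the successive sons. -/
inductive HalfEdgeMap.Describes {H : Type*} (M : HalfEdgeMap H) : PlaneTree → H → Prop
  | node (ts : List PlaneTree) (h : H)
      (degree : Function.minimalPeriod M.σ h = ts.length + 1)
      (sons : ∀ i : Fin ts.length, M.Describes (ts.get i) (M.α ((M.σ ^ (i.val + 1)) h))) :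
      M.Describes (PlaneTree.node ts) h

/-- The drawing `M` is (isomorphic to) the planted plane tree `t`. -/
def HalfEdgeMap.IsTree {H : Type*} (M : HalfEdgeMap H) (t : PlaneTree) : Prop :=
  M.Connected ∧ M.Describes t M.root

/-- The tree reduced to a root and a vertex. -/
def PlaneTree.tau : PlaneTree := .node []

/-- `σ(T₁, T₂)`: an edge is added from the root-vertex of `T₂` to the root-vertex of `T₁`, which
becomes the last son of the root-vertex of `T₂`. -/
def PlaneTree.sigma (T₁ : PlaneTree) : PlaneTree → PlaneTree
  | .node ts => .node (ts ++ [T₁])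

/-! ### The map `λ₀` -/

/-- The letters of tree-sequences. -/
inductive SeqLetter
  | u | v | tree (t : PlaneTree)

namespace SeqLetter

/-- Replaces the first occurrence of `v` by `u τ v`. -/
def expandFirstV : List SeqLetter → List SeqLetter
  | [] => []
  | v :: s => u :: tree PlaneTree.tau :: v :: s
  | x :: s => x :: expandFirstV s

/-- Replaces the first occurrence of `u` by `v τ u`. -/
def expandFirstU : List SeqLetter → List SeqLetter
  | [] => []
  | u :: s => v :: tree PlaneTree.tau :: u :: s
  | x :: s => x :: expandFirstU s

/-- Replaces the last occurrence of `u` by `u τ v` (the sequence is read from right to left). -/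
def expandLastU (s : List SeqLetter) : List SeqLetter := (expandFirstU s.reverse).reverse

/-- Replaces the factor `T₁ v T₂` at the first occurrence of `v` by `σ(T₁, T₂)`. -/
def mergeFirstV : List SeqLetter → List SeqLetter
  | tree T₁ :: v :: tree T₂ :: s => tree (PlaneTree.sigma T₁ T₂) :: s
  | x :: s => x :: mergeFirstV s
  | [] => []

/-- Replaces the factor `T₂ u T₁` at the first occurrence of `u` by `σ(T₁, T₂)`. -/
def mergeFirstU : List SeqLetter → List SeqLetter
  | tree T₂ :: u :: tree T₁ :: s => tree (PlaneTree.sigma T₁ T₂) :: s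
  | x :: s => x :: mergeFirstU s
  | [] => []

/-- Replaces the factor `T₁ u T₂` at the last occurrence of `u` by `σ(T₁, T₂)` (the sequence is
read from right to left). -/
def mergeLastU (s : List SeqLetter) : List SeqLetter := (mergeFirstU s.reverse).reverse

end SeqLetter

/-- One step of `λ₀`. -/
def lambda0Step (s : List SeqLetter) : Letter → List SeqLetter
  | .a => SeqLetter.expandLastU s
  | .b => SeqLetter.expandFirstV s
  | .abar => SeqLetter.mergeFirstV s
  | .bbar => SeqLetter.mergeLastU s

/-- The map `λ₀`, defined by recursion on the last letter of the word. -/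
def lambda0 (w : List Letter) : List SeqLetter :=
  w.foldl lambda0Step [.u, .tree PlaneTree.tau, .v]

/-! ### The map `λ₁` -/

/-- Binary trees: every vertex is a node, with a left and a right son, or a leaf. In
counterclockwise order around a node one finds the father (or the root), the left son and the
right son. Leaves carry a label. -/
inductive BinTree (A : Type)
  | leaf (x : A)
  | node (l r : BinTree A)

namespace BinTree

/-- The number of nodes. -/
def size {A : Type} : BinTree A → ℕ
  | leaf _ => 0
  | node l r => l.size + r.size + 1

/-- Forgets the labels. -/
def forget {A : Type} : BinTree A → BinTree Unit
  | leaf _ => leaf ()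
  | node l r => node l.forget r.forget

/-- Replaces the first active (label `true`) right leaf by `new`; `none` if there is no such leaf.
The Boolean tells whether the tree itself hangs as a right son. -/
def replaceFirstRight (new : BinTree Bool) : Bool → BinTree Bool → Option (BinTree Bool)
  | isRight, leaf active => if isRight && active then some new else none
  | _, node l r =>
    match replaceFirstRight new false l with
    | some l' => some (node l' r)
    | none => (replaceFirstRight new true r).map (fun r' => node l r')

/-- Replaces the last active left leaf by `new`; `none` if there is no such leaf. The Boolean tells
whether the tree itself hangs as a left son. -/
def replaceLastLeft (new : BinTree Bool) : Bool → BinTree Bool → Option (BinTree Bool)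
  | isLeft, leaf active => if isLeft && active then some new else none
  | _, node l r =>
    match replaceLastLeft new false r with
    | some r' => some (node l r')
    | none => (replaceLastLeft new true l).map (fun l' => node l' r)

end BinTree

/-- The binary tree `B₁`: a node and two active leaves. -/
def binB1 : BinTree Bool := .node (.leaf true) (.leaf true)

/-- One step of `λ₁`. The leaf to be replaced exists whenever the word is a prefix-shuffle. -/
def lambda1Step (B : BinTree Bool) : Letter → BinTree Bool
  | .a => (BinTree.replaceLastLeft binB1 false B).getD B
  | .b => (BinTree.replaceFirstRight binB1 false B).getD B
  | .abar => (BinTree.replaceFirstRight (.leaf false) false B).getD B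
  | .bbar => (BinTree.replaceLastLeft (.leaf false) false B).getD B

/-- The map `λ₁`, defined by recursion on the last letter of the word. -/
def lambda1 (w : List Letter) : BinTree Bool := w.foldl lambda1Step binB1

/-- The map `λ₁'`: all the leaves become inactive, so that only the binary tree remains. -/
def lambda1' (w : List Letter) : BinTree Unit := (lambda1 w).forget

/-! ### Contraction of the non-branching edges -/

/-- The position of a vertex in a binary tree. -/
inductive Position
  | root | left | right
  deriving DecidableEq

/-- An edge is branching if one of its ends is a right son and the other is a left son or the
root-vertex. -/
def Branching (p q : Position) : Prop :=
  (p = .right ∧ (q = .left ∨ q = .root)) ∨ (q = .right ∧ (p = .left ∨ p = .root))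

instance (p q : Position) : Decidable (Branching p q) := by
  unfold Branching; infer_instance

/-- The sons of the vertex that arises from the top vertex of a binary tree (which hangs at
position `p`) when all the non-branching edges below it are contracted: a son joined by a branching
edge stays a son, a son joined by a non-branching edge is replaced by its own sons. -/
def contractedSons : Position → BinTree Unit → List PlaneTree
  | _, .leaf _ => []
  | p, .node l r =>
    (if Branching p .left then [PlaneTree.node (contractedSons .left l)]
      else contractedSons .left l) ++
    (if Branching p .right then [PlaneTree.node (contractedSons .right r)]
      else contractedSons .right r)

/-- The map `θ`: contraction of all the non-branching edges. -/
def theta (B : BinTree Unit) : PlaneTree := .node (contractedSons .root B)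

/-! ### Non-crossing partitions, their dual trees, and the map `Θ` -/

def IsNonCrossing {m : ℕ} (P : Setoid (Fin m)) : Prop :=
  ∀ a b c d : Fin m, a < b → b < c → c < d → P a c → P b d → P a b

/-- The cyclic successor of a point in its part. -/
noncomputable def nextInPart {m : ℕ} (P : Setoid (Fin m)) : Equiv.Perm (Fin m) :=
  firstReturn (finRotate m) (fun i => (Quotient.mk P i : Quotient P))

/-- The dual of the cell-representation of a partition `P` of the points `0 < ⋯ < m - 1` on the
horizontal axis, whose parts are cells in the lower half-plane. Draw a vertex in each part and in
each anti-part; each side of a cell, say from the point `i` to its cyclic successor in the part,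
gives one dual edge.

The half of this edge in the part is `Sum.inr i`; the sides of a part follow each other in
decreasing order counterclockwise. The half in the anti-part is `Sum.inl i.succ`, where `i.succ`
stands for the gap on the right of `i`; the gap on the left of `i` is `i.castSucc`.
Counterclockwise around the anti-part, the side that starts at `i` is followed by the side that
starts at the gap on the left of the cyclic successor of `i`. The gap `0`, on the left of all the
points, is the root, in the infinite anti-part, and is followed by the last gap. -/
noncomputable def dualMap {m : ℕ} (P : Setoid (Fin m)) : HalfEdgeMap (Fin (m + 1) ⊕ Fin m) where
  σ := Equiv.sumCongr
    ((finSuccEquiv m).trans ((nextInPart P).optionCongr.trans finSuccEquivLast.symm))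
    (nextInPart P).symm
  α := Sum.elim (Fin.cases (Sum.inl 0) Sum.inr) (fun i => Sum.inl i.succ)
  α_invol := by
    rintro (i | i)
    · refine Fin.cases ?_ (fun j => ?_) i <;> simp
    · simp
  root := Sum.inl 0
  α_root := by simp

/-- `P = Θ(B) = Υ⁻¹(θ(B))`: the partition `P` is non-crossing and its dual tree `Υ(P)` is `θ(B)`. -/
def IsTheta {m : ℕ} (B : BinTree Unit) (P : Setoid (Fin m)) : Prop :=
  IsNonCrossing P ∧ (dualMap P).IsTree (theta B)

/-! Both components of `Φ` are produced by one walk, the tour of `T`. By Euler's formula for `M` and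
for `T`, the edges of `T` do not cross each other along the tour, and neither do the other edges
(`not_crossing`, `not_crossing_of_spanningTree`). Hence the open edges of either kind form a stack.

At each moment of the tour the known part of the vertex explosion consists of a current subtree `C`,
a completed subtree for every open edge outside `T` (the stack `L`), and an unfinished subtree for
every open edge of `T` (the stack `R`). Each letter either pushes `C` on a stack and starts a new
vertex, or pops a stack and joins the popped subtree to `C`. In the tree-sequence the last `u` and
the first `v` are the neighbours of `C`, so these are exactly the steps of `λ₀`. In the binary tree
of `λ₁` the nodes, read from right to left, are the vertices of the explosion in prefix order, and a
chain of right sons collects the vertices that come from one vertex of `M`. Indeed `a` enters a new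
vertex of `M` and opens a chain, whereas `b` stays at the same vertex and prolongs its chain. The
invariant is `IsTourState`, preserved by `IsTourState.step`.

The map `Θ` is treated apart from maps. The chain labels of a binary tree, read from right to left,
form a non-crossing word, and every non-crossing word arises in this way (`ChainLabels.nonCrossing`,
`NonCrossingList.exists_chainLabels`). The partition into equal labels has `theta B` as its dual
tree (`ChainLabels.sons_dualMap`). Bijectivity follows, because `theta` is injective and the tree
determines which labels agree (`ChainLabels.eq_iff_eq`).

The two threads meet because the order of appearance around a plane tree is the prefix order
(`Sons.verticesFrom`): the word of chain labels of `λ₁'(w)` then lists the classes of `φ₁`. -/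

namespace HalfEdgeMap

/-! ### Reading a plane tree off a drawing -/

variable {H : Type*}

/-- Counterclockwise after its head `h`, a vertex has the sons described by `ts`, and the half-edge
that follows them is `x`. The list `ls` contains the heads of the vertices of these subtrees in
prefix order. -/
inductive Sons (M : HalfEdgeMap H) : H → List PlaneTree → H → List H → Prop
  | nil (h : H) : Sons M h [] (M.σ h) []
  | snoc {h x : H} {ts us : List PlaneTree} {ls ls' : List H} :
      Sons M h ts x ls → x ≠ h → Sons M (M.α x) us (M.α x) ls' →
      Sons M h (ts ++ [.node us]) (M.σ x) (ls ++ M.α x :: ls')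

theorem describes_node_of_pow {M : HalfEdgeMap H} {h : H} {ts : List PlaneTree}
    (hx : (M.σ ^ (ts.length + 1)) h = h)
    (hs : ∀ i (hi : i < ts.length), (M.σ ^ (i + 1)) h ≠ h ∧
      M.Describes ts[i] (M.α ((M.σ ^ (i + 1)) h))) : M.Describes (.node ts) h := by
  refine .node ts h ?_ fun i => (hs i i.2).2
  have hp : Function.IsPeriodicPt M.σ (ts.length + 1) h := by
    rw [Function.IsPeriodicPt, Equiv.Perm.iterate_eq_pow]; exact hx
  have hle := hp.minimalPeriod_le (Nat.succ_pos _)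
  have hpos := hp.minimalPeriod_pos (Nat.succ_pos _)
  -- A smaller period would be `i + 1` for some `i < ts.length`, and `hs` excludes a return to `h`
  -- there.
  by_contra hne
  have h1 := (hs (Function.minimalPeriod M.σ h - 1) (by omega)).1
  rw [Nat.sub_add_cancel hpos, ← Equiv.Perm.iterate_eq_pow] at h1
  exact h1 (Function.isPeriodicPt_minimalPeriod _ _)

theorem Sons.spec {M : HalfEdgeMap H} {h x : H} {ts : List PlaneTree} {ls : List H}
    (hs : M.Sons h ts x ls) : (M.σ ^ (ts.length + 1)) h = x ∧
      ∀ i (hi : i < ts.length), (M.σ ^ (i + 1)) h ≠ h ∧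
        M.Describes ts[i] (M.α ((M.σ ^ (i + 1)) h)) := by
  induction hs with
  | nil h => simp
  | @snoc h x ts us ls ls' _ hne _ ih1 ih2 =>
    obtain ⟨hx, hd⟩ := ih1
    refine ⟨by rw [List.length_append, List.length_singleton, pow_succ', Equiv.Perm.mul_apply, hx],
      fun i hi => ?_⟩
    rcases Nat.lt_or_ge i ts.length with h1 | h1
    · rw [List.getElem_append_left h1]
      exact hd i h1
    · obtain rfl : i = ts.length := by
        simp only [List.length_append, List.length_singleton] at hi; omega
      rw [hx]
      refine ⟨hne, ?_⟩
      simpa using describes_node_of_pow ih2.1 ih2.2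

theorem Sons.describes {M : HalfEdgeMap H} {h : H} {ts : List PlaneTree} {ls : List H}
    (hs : M.Sons h ts h ls) : M.Describes (.node ts) h :=
  describes_node_of_pow hs.spec.1 hs.spec.2

/-- The degree fixes the number of sons, and the half-edge leading to a son fixes its subtree.
Together with `theta_injective` this makes `B` a function of `P` in `IsTheta B P`. -/
theorem Describes.unique {M : HalfEdgeMap H} {h : H} {t t' : PlaneTree} (h1 : M.Describes t h)
    (h2 : M.Describes t' h) : t = t' := by
  induction h1 generalizing t' with
  | node ts h deg sons ih =>
    cases h2 with
    | node ts' _ deg' sons' =>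
      have hl : ts.length = ts'.length := by omega
      congr 1
      refine List.ext_get hl fun i hi hi' => ih ⟨i, hi⟩ (sons' ⟨i, hi'⟩)

end HalfEdgeMap

/-! ### Chain labels of binary trees -/

/-- The nodes of a binary tree, read from right to left, carry the labels `s`, in such a way that
two nodes have the same label if and only if they lie on the same chain of right sons. With
`o = some v`, the tree hangs as a right son at a node with label `v`. -/
inductive ChainLabels {A : Type} {V : Type*} : Option V → BinTree A → List V → Prop
  | leaf (o : Option V) (x : A) : ChainLabels o (.leaf x) []
  | node {o : Option V} {v : V} {l r : BinTree A} {s t : List V} (ho : ∀ w ∈ o, w = v) :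
      ChainLabels (some v) r s → ChainLabels none l t → v ∉ t → s.Disjoint t →
      ChainLabels o (.node l r) (s ++ v :: t)

namespace ChainLabels

variable {A : Type} {V : Type*}

theorem size_eq {o : Option V} {B : BinTree A} {s : List V} (h : ChainLabels o B s) :
    B.size = s.length := by
  induction h with
  | leaf => rfl
  | node ho _ _ _ _ ih1 ih2 => simp [BinTree.size, ih1, ih2]; omega

/-- If `o = some v`, then `v` is the first label. -/
theorem append_singleton {o : Option V} {B : BinTree A} {s : List V} (h : ChainLabels o B s) :
    ∀ v ∈ o, ∃ t, s ++ [v] = v :: t := by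
  induction h with
  | leaf => intro v _; exact ⟨[], rfl⟩
  | @node o w l r s t ho _ _ _ _ ih1 ih2 =>
    intro v hv
    obtain rfl := ho v hv
    obtain ⟨q, hq⟩ := ih1 v rfl
    refine ⟨q ++ (t ++ [v]), ?_⟩
    rw [← List.cons_append, ← hq]; simp

end ChainLabels

/-! ### Non-crossing words -/

/-- No two labels alternate four times. -/
def NonCrossingList {V : Type*} (s : List V) : Prop := ∀ a b : V, [a, b, a, b].Sublist s → a = b

theorem NonCrossingList.of_sublist {V : Type*} {s t : List V} (ht : NonCrossingList t)
    (h : s.Sublist t) : NonCrossingList s := fun a b hab => ht a b (hab.trans h)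

/-- The top of a chain is read last among the nodes of the chain. So the word is cut at the last
occurrence of its first letter `v`: what precedes becomes the right subtree, which begins with `v`
again unless it is empty, and what follows becomes the left subtree. A letter on both sides would
alternate with `v`. The condition on `o` lets a right subtree continue the chain of its father. -/
theorem NonCrossingList.exists_chainLabels {V : Type*} (s : List V) (hs : NonCrossingList s)
    (o : Option V) (ho : ∀ v ∈ o, ∀ w ∈ s.head?, v = w) :
    ∃ B : BinTree Unit, ChainLabels o B s := by
  classical
  induction hn : s.length using Nat.strong_induction_on generalizing s o with
  | _ n ih =>
    subst hn
    rcases s with _ | ⟨v, s⟩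
    · exact ⟨.leaf (), .leaf _ _⟩
    · obtain ⟨p, q, hpq, hq⟩ : ∃ p q, v :: s = p ++ v :: q ∧ v ∉ q := by
        obtain ⟨a, b, hab, h⟩ := List.eq_append_cons_of_mem (a := v) (xs := (v :: s).reverse) (by simp)
        refine ⟨b.reverse, a.reverse, ?_, by simpa using h⟩
        have := congrArg List.reverse hab
        simpa using this
      have hp : ∀ w ∈ p.head?, v = w := by
        rcases p with _ | ⟨x, p⟩
        · simp
        · simp at hpq; simp [hpq.1]
      rw [hpq] at hs ih
      obtain ⟨r, hr⟩ := ih p.length (by simp) p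
        (hs.of_sublist (by simp)) (some v) (by simpa using hp) rfl
      obtain ⟨l, hl⟩ := ih q.length (by simp; omega) q
        (hs.of_sublist ((List.sublist_cons_self v q).trans (List.sublist_append_right _ _)))
        none (by simp) rfl
      refine ⟨.node l r, ?_⟩
      rw [hpq]
      refine .node (fun w hw => ho w hw v (by simp)) hr hl hq ?_
      intro x hx hx'
      rcases p with _ | ⟨y, p⟩
      · simp at hx
      · obtain rfl : v = y := hp y (by simp)
        have hxv : x ≠ v := fun h => hq (h ▸ hx')
        have hxp : x ∈ p := by simpa [hxv] using hx
        refine hxv (hs v x ?_).symm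
        have h1 : [x].Sublist p := by simpa using hxp
        have h2 : [x].Sublist q := by simpa using hx'
        exact (h1.append (h2.cons_cons v)).cons_cons v

/-- The two final letters are equal and adjacent, so an alternation of different letters uses at
most one of them. -/
theorem NonCrossingList.append_self {V : Type*} {s : List V} {v : V}
    (h : NonCrossingList (s ++ [v])) : NonCrossingList (s ++ [v] ++ [v]) := by
  intro a b hab
  by_contra hne
  obtain ⟨l₁, l₂, hl, h₁, h₂⟩ := List.sublist_append_iff.mp hab
  rcases List.sublist_singleton.mp h₂ with rfl | rfl
  · exact hne (h a b (by simpa [hl] using h₁))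
  · rw [show [a, b, a, b] = [a, b, a] ++ [b] from rfl] at hl
    obtain ⟨rfl, hb⟩ := List.append_inj' hl rfl
    obtain rfl : b = v := by simpa using hb
    obtain ⟨l₃, l₄, hl', h₃, h₄⟩ := List.sublist_append_iff.mp h₁
    rcases List.sublist_singleton.mp h₄ with rfl | rfl
    · rw [List.append_nil] at hl'
      subst hl'
      exact hne (h a b (h₃.append (List.Sublist.refl [b])))
    · rw [show [a, b, a] = [a, b] ++ [a] from rfl] at hl'
      obtain ⟨-, hb⟩ := List.append_inj' hl' rfl
      exact hne (by simpa using hb)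

/-- Two letters of `t` can only cross inside `t`, and two letters foreign to `t` only inside `s ++
u`. A letter of `t` occurs only in the contiguous block `t`, so it cannot alternate with a foreign
one. -/
theorem NonCrossingList.insert_block {V : Type*} {s t u : List V} (hsu : NonCrossingList (s ++ u))
    (ht : NonCrossingList t) (hs : s.Disjoint t) (hu : u.Disjoint t) :
    NonCrossingList (s ++ (t ++ u)) := by
  classical
  intro a b hab
  have hf (p : V → Bool) := hab.filter p
  by_cases ha : a ∈ t <;> by_cases hb : b ∈ t
  · refine ht a b ?_
    have h1 := hf (fun x => decide (x ∈ t))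
    have e1 : s.filter (fun x => decide (x ∈ t)) = [] := by
      simpa [List.filter_eq_nil_iff] using fun x hx hx' => hs hx hx'
    have e2 : u.filter (fun x => decide (x ∈ t)) = [] := by
      simpa [List.filter_eq_nil_iff] using fun x hx hx' => hu hx hx'
    have e3 : t.filter (fun x => decide (x ∈ t)) = t := by simp [List.filter_eq_self]
    simpa [List.filter_append, e1, e2, e3, ha, hb] using h1
  · obtain ⟨l₁, l₂, hl, h₁, h₂⟩ := List.sublist_append_iff.mp hab
    obtain ⟨l₃, l₄, rfl, h₃, h₄⟩ := List.sublist_append_iff.mp h₂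
    have a1 : a ∉ l₁ := fun h => hs (h₁.subset h) ha
    have a4 : a ∉ l₄ := fun h => hu (h₄.subset h) ha
    have b3 : b ∉ l₃ := fun h => hb (h₃.subset h)
    clear hf h₁ h₂ h₃ h₄ hab
    rcases l₁ with _ | ⟨x, l₁⟩
    · rcases l₃ with _ | ⟨x, _ | ⟨y, l₃⟩⟩ <;> grind
    · grind
  · obtain ⟨l₁, l₂, hl, h₁, h₂⟩ := List.sublist_append_iff.mp hab
    obtain ⟨l₃, l₄, rfl, h₃, h₄⟩ := List.sublist_append_iff.mp h₂
    have b1 : b ∉ l₁ := fun h => hs (h₁.subset h) hb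
    have b4 : b ∉ l₄ := fun h => hu (h₄.subset h) hb
    have a3 : a ∉ l₃ := fun h => ha (h₃.subset h)
    clear hf h₁ h₂ h₃ h₄ hab
    rcases l₁ with _ | ⟨x, _ | ⟨y, l₁⟩⟩
    · rcases l₃ with _ | ⟨x, l₃⟩ <;> grind
    · rcases l₃ with _ | ⟨x, _ | ⟨y, l₃⟩⟩ <;> grind
    · grind
  · refine hsu a b ?_
    have h1 := hf (fun x => decide (x ∉ t))
    have e1 : s.filter (fun x => decide (x ∉ t)) = s := by
      simpa [List.filter_eq_self] using fun x hx hx' => hs hx hx'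
    have e2 : u.filter (fun x => decide (x ∉ t)) = u := by
      simpa [List.filter_eq_self] using fun x hx hx' => hu hx hx'
    have e3 : t.filter (fun x => decide (x ∉ t)) = [] := by simp [List.filter_eq_nil_iff]
    rw [List.filter_append, List.filter_append, e1, e2, e3] at h1
    simpa [ha, hb] using h1

/-- The father's label is appended because a right subtree continues the father's chain. At a node,
the left subtree is a block of fresh letters inserted into `s ++ [v]` followed by the father's
label, which can only be another `v`. -/
theorem ChainLabels.nonCrossing {A : Type} {V : Type*} {o : Option V} {B : BinTree A} {s : List V}
    (h : ChainLabels o B s) : NonCrossingList (s ++ o.toList) := by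
  induction h with
  | leaf o =>
    intro a b hab
    have := hab.length_le
    cases o <;> simp at this
  | @node o v l r s t ho _ _ hv hd ih1 ih2 =>
    have ho' : o.toList.Sublist [v] := by
      cases o with
      | none => simp
      | some w => simp [ho w rfl]
    have h1 : NonCrossingList ((s ++ [v]) ++ (t ++ o.toList)) := by
      refine (ih1.append_self.of_sublist (ho'.append_left _)).insert_block (by simpa using ih2) ?_ ?_
      · intro x hx hx'
        rcases List.mem_append.mp hx with hx | hx
        · exact hd hx hx'
        · exact hv (by simpa using List.mem_singleton.mp hx ▸ hx')
      · intro x hx hx'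
        exact hv (List.mem_singleton.mp (ho'.subset hx) ▸ hx')
    simpa using h1

/-! ### Contraction of the non-branching edges is injective -/

theorem contractedSons_root (B : BinTree Unit) :
    contractedSons .root B = contractedSons .left B := by
  cases B <;> simp [contractedSons, Branching]

theorem contractedSons_leaf (p : Position) (x : Unit) : contractedSons p (.leaf x) = [] := by
  simp [contractedSons]

theorem contractedSons_left_node (l r : BinTree Unit) : contractedSons .left (.node l r) =
    contractedSons .left l ++ [.node (contractedSons .right r)] := by
  simp [contractedSons, Branching]

theorem contractedSons_right_node (l r : BinTree Unit) : contractedSons .right (.node l r) =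
    .node (contractedSons .left l) :: contractedSons .right r := by
  simp [contractedSons, Branching]

/-- The list of sons can be parsed back. In left position its last entry comes from the right
subtree and the others from the left subtree; in right position its first entry comes from the left
subtree and the others from the right subtree. The two statements feed each other. -/
theorem contractedSons_injective (B B' : BinTree Unit) :
    (contractedSons .left B = contractedSons .left B' → B = B') ∧
      (contractedSons .right B = contractedSons .right B' → B = B') := by
  induction B generalizing B' with
  | leaf x =>
    cases B' with
    | leaf y => simp
    | node l r =>
      simp [contractedSons_left_node, contractedSons_right_node, contractedSons_leaf]
  | node l r ihl ihr =>
    cases B' with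
    | leaf y => simp [contractedSons_left_node, contractedSons_right_node, contractedSons_leaf]
    | node l' r' =>
      rw [contractedSons_left_node, contractedSons_right_node, contractedSons_left_node,
        contractedSons_right_node]
      constructor
      · intro h
        obtain ⟨h1, h2⟩ := List.append_inj' h rfl
        simp only [List.cons.injEq, PlaneTree.node.injEq, and_true] at h2
        rw [(ihl l').1 h1, (ihr r').2 h2]
      · intro h
        simp only [List.cons.injEq, PlaneTree.node.injEq] at h
        rw [(ihl l').1 h.1, (ihr r').2 h.2]

theorem theta_injective : Function.Injective theta := by
  intro B B' h
  simp only [theta, PlaneTree.node.injEq, contractedSons_root] at h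
  exact (contractedSons_injective B B').1 h

/-! ### The dual map of a chain-labelled binary tree -/

theorem firstReturn_eq {H ι : Type*} [Finite H] (σ : Equiv.Perm H) (c : H → ι) (x : H) (k : ℕ)
    (hk : 0 < k) (h : c ((σ ^ k) x) = c x) (hmin : ∀ j, 0 < j → j < k → c ((σ ^ j) x) ≠ c x) :
    firstReturn σ c x = (σ ^ k) x := by
  have : sInf {k : ℕ | 0 < k ∧ c ((σ ^ k) x) = c x} = k := by
    refine le_antisymm (Nat.sInf_le ⟨hk, h⟩) ?_
    obtain ⟨h1, h2⟩ := Nat.sInf_mem (s := {k : ℕ | 0 < k ∧ c ((σ ^ k) x) = c x}) ⟨k, hk, h⟩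
    by_contra hlt
    exact hmin _ h1 (not_le.mp hlt) h2
  simp [firstReturn, firstReturnFun, this]

theorem finRotate_pow_val {m : ℕ} (k : ℕ) (i : Fin m) :
    ((finRotate m ^ k) i).val = (i.val + k) % m := by
  rcases m with _ | m
  · exact i.elim0
  · induction k with
    | zero => simp [Nat.mod_eq_of_lt i.2]
    | succ k ih =>
      rw [pow_succ', Equiv.Perm.mul_apply, finRotate_apply, Fin.val_add, ih]
      simp [← add_assoc]

theorem nextInPart_eq {m : ℕ} (P : Setoid (Fin m)) (i j : Fin m) (k : ℕ) (hk : 0 < k)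
    (hj : (i.val + k) % m = j.val) (hP : P i j)
    (hmin : ∀ x : Fin m, ∀ l, 0 < l → l < k → (i.val + l) % m = x.val → ¬ P i x) :
    nextInPart P i = j := by
  have hr : (finRotate m ^ k) i = j := Fin.ext (by rw [finRotate_pow_val, hj])
  rw [nextInPart, firstReturn_eq _ _ _ k hk, hr]
  · rw [hr]
    exact Quotient.sound (P.symm hP)
  · intro l h0 hl h
    exact hmin _ l h0 hl (finRotate_pow_val l i).symm (P.symm (Quotient.exact h))

/-- `j` is the cyclic successor of `i` in its part. -/
def NextIs {m : ℕ} (P : Setoid (Fin m)) (i j : ℕ) : Prop :=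
  ∃ (hi : i < m) (hj : j < m), nextInPart P ⟨i, hi⟩ = ⟨j, hj⟩

section

variable {V : Type*} {w : List V} {P : Setoid (Fin w.length)}

theorem nextIs_of_eq_append (hP : ∀ i j, P i j ↔ w[i] = w[j]) {p q r : List V} {v : V}
    (hw : w = p ++ (v :: q) ++ v :: r) (hq : v ∉ q) :
    NextIs P p.length (p.length + (q.length + 1)) := by
  subst hw
  refine ⟨by simp, by simp, nextInPart_eq P _ _ (q.length + 1) (by simp) ?_ ?_ ?_⟩
  · exact Nat.mod_eq_of_lt (by simp)
  · rw [hP]; simp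
  · intro x l h0 hl hx h
    rw [Nat.mod_eq_of_lt (by simp; omega)] at hx
    rw [hP] at h
    obtain ⟨x, hx'⟩ := x
    simp only at hx
    subst hx
    obtain ⟨l, rfl⟩ := Nat.exists_eq_succ_of_ne_zero h0.ne'
    apply hq
    simp [show l < q.length by omega] at h
    rw [h]; exact List.getElem_mem _

/-- From the last occurrence of `v` the rotation runs through `r` and then `p`, which do not contain
`v`, and lands on the first occurrence. The equation `hq` says that `q` begins with `v` unless it is
empty, so a part with a single point is included. -/
theorem nextIs_wrap (hP : ∀ i j, P i j ↔ w[i] = w[j]) {p q q' r : List V} {v : V}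
    (hw : w = p ++ q ++ v :: r) (hq : q ++ [v] = v :: q') (hp : v ∉ p) (hr : v ∉ r) :
    NextIs P (p.length + q.length) p.length := by
  subst hw
  have hv : (q ++ v :: r)[0]'(by simp) = v := by
    have : (q ++ v :: r) = v :: q' ++ r := by rw [← hq]; simp
    simp [this]
  refine ⟨by simp, by simp, nextInPart_eq P _ _ (r.length + 1 + p.length) (by omega) ?_ ?_ ?_⟩
  · have : p.length + q.length + (r.length + 1 + p.length) =
      p.length + (p ++ q ++ v :: r).length := by simp; omega
    simp only [this, Nat.add_mod_right]
    exact Nat.mod_eq_of_lt (by simp)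
  · rw [hP]
    have : (p ++ q ++ v :: r)[p.length]'(by simp) = v := by
      simp only [List.append_assoc]
      rw [List.getElem_append_right le_rfl]
      simpa using hv
    simp only [Fin.getElem_fin, this]
    rw [List.getElem_append_right (by simp)]
    simp
  · intro x l h0 hl hx h
    rw [hP] at h
    have h1 : (p ++ q ++ v :: r)[p.length + q.length]'(by simp) = v := by
      rw [List.getElem_append_right (by simp)]
      simp
    simp only [Fin.getElem_fin, h1] at h
    rcases Nat.lt_or_ge (p.length + q.length + l) (p ++ q ++ v :: r).length with hlt | hge
    · rw [Nat.mod_eq_of_lt hlt] at hx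
      simp only [← hx] at h
      rw [List.getElem_append_right (by simp)] at h
      obtain ⟨l, rfl⟩ := Nat.exists_eq_succ_of_ne_zero h0.ne'
      apply hr
      rw [h]
      simp [show p.length + q.length + (l + 1) - (p.length + q.length) = l + 1 by omega]
    · rw [Nat.mod_eq_sub_mod hge, Nat.mod_eq_of_lt (by simp at hge ⊢; omega)] at hx
      simp only [← hx] at h
      have hlt : p.length + q.length + l - (p ++ q ++ v :: r).length < p.length := by
        simp at hge ⊢; omega
      apply hp
      simp only [List.append_assoc] at h hlt
      rw [List.getElem_append_left hlt] at h
      rw [h]; exact List.getElem_mem _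

end

/-- The half-edge of the dual map in the gap on the left of the point `x`. -/
def gapHalf (m x : ℕ) : Fin (m + 1) ⊕ Fin m := .inl (Fin.ofNat (m + 1) x)

/-- The half-edge of the dual map in the part of the point `x`, for the side starting at `x`. -/
def partHalf (m x : ℕ) : Fin (m + 1) ⊕ Fin m := if h : x < m then .inr ⟨x, h⟩ else .inl 0

section

variable {m : ℕ} (P : Setoid (Fin m))

theorem gapHalf_eq {x : ℕ} (hx : x ≤ m) : gapHalf m x = .inl ⟨x, Nat.lt_succ_of_le hx⟩ := by
  simp [gapHalf, Fin.ofNat, Nat.mod_eq_of_lt (Nat.lt_succ_of_le hx)]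

theorem gapHalf_ne {x y : ℕ} (hx : x ≤ m) (hy : y ≤ m) (h : x ≠ y) : gapHalf m x ≠ gapHalf m y := by
  simp [gapHalf_eq hx, gapHalf_eq hy, h]

theorem partHalf_eq {x : ℕ} (hx : x < m) : partHalf m x = .inr ⟨x, hx⟩ := by
  simp [partHalf, hx]

theorem partHalf_ne {x y : ℕ} (hx : x < m) (hy : y < m) (h : x ≠ y) :
    partHalf m x ≠ partHalf m y := by
  simp [partHalf_eq hx, partHalf_eq hy, h]

theorem dualMap_α_gapHalf {x : ℕ} (hx : x < m) :
    (dualMap P).α (gapHalf m (x + 1)) = partHalf m x := by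
  rw [gapHalf_eq hx, partHalf_eq hx]
  exact congrArg (fun f => f) (Fin.cases_succ (motive := fun _ => Fin (m + 1) ⊕ Fin m)
    (zero := Sum.inl 0) (succ := Sum.inr) (⟨x, hx⟩ : Fin m))

theorem dualMap_α_partHalf {x : ℕ} (hx : x < m) :
    (dualMap P).α (partHalf m x) = gapHalf m (x + 1) := by
  rw [← dualMap_α_gapHalf P hx, (dualMap P).α_invol]

theorem dualMap_σ_gapHalf_zero : (dualMap P).σ (gapHalf m 0) = gapHalf m m := by
  rw [gapHalf_eq (Nat.zero_le m), gapHalf_eq le_rfl]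
  simp [dualMap, Fin.last]

theorem dualMap_σ_gapHalf {i j : ℕ} (h : NextIs P i j) :
    (dualMap P).σ (gapHalf m (i + 1)) = gapHalf m j := by
  obtain ⟨hi, hj, h⟩ := h
  rw [gapHalf_eq hi, gapHalf_eq hj.le]
  have : (⟨i + 1, Nat.lt_succ_of_le hi⟩ : Fin (m + 1)) = Fin.succ ⟨i, hi⟩ := rfl
  have h2 : finSuccEquiv m (⟨i + 1, Nat.lt_succ_of_le hi⟩ : Fin (m + 1)) = some ⟨i, hi⟩ := by
    rw [this, finSuccEquiv_succ]
  simp [dualMap, h2, h]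

theorem dualMap_σ_partHalf {i j : ℕ} (h : NextIs P i j) :
    (dualMap P).σ (partHalf m j) = partHalf m i := by
  obtain ⟨hi, hj, h⟩ := h
  rw [partHalf_eq hi, partHalf_eq hj]
  simp [dualMap, ← h]

/-- The gap `i + 1` is joined to the gap `i`: go through the side starting at `i` into its part,
turn to the side that ends at `i`, leave through that side, and turn once more in the anti-part. -/
theorem dualMap_connected : (dualMap P).Connected := by
  have hα (i : Fin m) : (dualMap P).Reach (.inr i) (.inl i.succ) := .rel _ _ (.inr rfl)
  have hroot : ∀ i : Fin (m + 1), (dualMap P).Reach (.inl i) (.inl 0) := by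
    intro i
    induction i using Fin.induction with
    | zero => exact .refl _
    | succ i ih =>
      refine .trans _ _ _ ?_ ih
      have h1 : (dualMap P).Reach (.inr i) (.inr ((nextInPart P).symm i)) := .rel _ _ (.inl rfl)
      have h2 : (dualMap P).Reach (.inl ((nextInPart P).symm i).succ) (.inl i.castSucc) :=
        .rel _ _ (.inl (by simp [dualMap]))
      exact ((hα i).symm.trans _ _ _ h1).trans _ _ _ ((hα _).trans _ _ _ h2)
  have hall : ∀ x, (dualMap P).Reach x (.inl 0) := by
    rintro (i | i)
    · exact hroot i
    · exact (hα i).trans _ _ _ (hroot _)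
  exact fun x y => (hall x).trans _ _ _ (hall y).symm

end

/-- Apart from one wrap-around, turning counterclockwise around a part or an anti-part goes from
right to left along the line. A subtree in left position occupies a factor `s` whose letters occur
nowhere else; its outermost parts are met when one turns around their anti-part from the gap after
`s` to the gap before `s`. A subtree in right position continues the chain of `v`; the anti-parts
behind its points labelled `v` are met when one turns around that part from the `v` following `s`
downwards. The last hypothesis of each half ensures that the turn does not come back to its starting
half-edge `h` too early. -/
theorem ChainLabels.sons_dualMap {V : Type*} {w : List V} {P : Setoid (Fin w.length)}
    (hP : ∀ i j, P i j ↔ w[i] = w[j]) (B : BinTree Unit) :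
    (∀ s p q : List V, ChainLabels none B s → w = p ++ s ++ q → s.Disjoint p → s.Disjoint q →
      ∀ h ts ls, (dualMap P).Sons h ts (gapHalf w.length (p.length + s.length)) ls →
        (∀ x, p.length < x → x ≤ p.length + s.length → gapHalf w.length x ≠ h) →
        ∃ ls', (dualMap P).Sons h (ts ++ contractedSons .left B) (gapHalf w.length p.length) ls') ∧
    (∀ s p q : List V, ∀ v, ChainLabels (some v) B s → w = p ++ s ++ v :: q →
      (∀ x ∈ s, x ≠ v → x ∉ p ∧ x ∉ q) →
      ∀ h ts ls,
        (dualMap P).Sons h ts ((dualMap P).σ (partHalf w.length (p.length + s.length))) ls →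
        (∀ x, p.length ≤ x → x < p.length + s.length → partHalf w.length x ≠ h) →
        ∃ ls', (dualMap P).Sons h (ts ++ contractedSons .right B)
          ((dualMap P).σ (partHalf w.length p.length)) ls') := by
  induction B with
  | leaf x =>
    constructor
    · intro s p q hs hw _ _ h ts ls hts _
      cases hs
      exact ⟨ls, by simpa [contractedSons_leaf] using hts⟩
    · intro s p q v hs hw _ h ts ls hts _
      cases hs
      exact ⟨ls, by simpa [contractedSons_leaf] using hts⟩
  | node l r ihl ihr =>
    constructor
    · intro s p q hs hw hp hq h ts ls hts hh
      cases hs with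
      | @node _ v _ _ s t _ hr hl hv hst =>
        have hw' : w = p ++ s ++ v :: (t ++ q) := by rw [hw]; simp
        have hlen : w.length = p.length + s.length + 1 + t.length + q.length := by
          rw [hw]; simp; omega
        have hk : p.length + s.length < w.length := by omega
        obtain ⟨s', hs'⟩ := hr.append_singleton v rfl
        have hvp : v ∉ p := hp (by simp)
        have hvq : v ∉ q := hq (by simp)
        -- The part of `v` reaches from `p.length` to `p.length + s.length`. Its wrap-around side is
        -- entered from the gap after its last point, and the anti-part continues with the gap
        -- before its first point.
        have hnext := nextIs_wrap hP hw' hs' hvp (by simp [hv, hvq])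
        obtain ⟨ls₁, h₁⟩ := ihl.1 t (p ++ s ++ [v]) q hl (by rw [hw]; simp)
          (by
            intro x hx hx'
            simp only [List.mem_append, List.mem_singleton] at hx'
            rcases hx' with (hx' | hx') | rfl
            · exact hp (by simp [hx]) hx'
            · exact hst hx' hx
            · exact hv hx)
          (fun x hx => hq (by simp [hx])) h ts ls
          (by convert hts using 2; simp; omega)
          (fun x hx hx' => hh x (by simp at hx; omega) (by simp at hx' ⊢; omega))
        rw [show (p ++ s ++ [v]).length = p.length + s.length + 1 by simp; omega] at h₁
        obtain ⟨ls₂, h₂⟩ := ihr.2 s p (t ++ q) v hr hw'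
          (fun x hx hxv => ⟨hp (by simp [hx]), by
            simp only [List.mem_append, not_or]
            exact ⟨fun h => hst hx h, hq (by simp [hx])⟩⟩)
          (partHalf w.length (p.length + s.length)) [] [] (.nil _)
          (fun x _ hx => partHalf_ne (hx.trans hk) hk hx.ne)
        rw [dualMap_σ_partHalf P hnext, ← dualMap_α_gapHalf P hk] at h₂
        have h₃ := HalfEdgeMap.Sons.snoc h₁ (hh _ (by omega) (by simp)) h₂
        rw [dualMap_σ_gapHalf P hnext] at h₃
        refine ⟨ls₁ ++ (dualMap P).α (gapHalf w.length (p.length + s.length + 1)) :: ls₂, ?_⟩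
        rw [contractedSons_left_node, ← List.append_assoc]
        exact h₃
    · intro s p q v hs hw hpq h ts ls hts hh
      cases hs with
      | @node _ v' _ _ s t ho hr hl hv hst =>
        obtain rfl := ho v rfl
        have hw' : w = p ++ s ++ v :: (t ++ v :: q) := by rw [hw]; simp
        have hlen : w.length = p.length + s.length + 1 + t.length + 1 + q.length := by
          rw [hw]; simp; omega
        have hk : p.length + s.length < w.length := by omega
        -- The point `p.length + s.length` and the `v` after the whole factor are consecutive in
        -- their part. The factor `t` lies between them, in the anti-part behind this side.
        have hnext := nextIs_of_eq_append hP (p := p ++ s) (q := t) (r := q) (v := v)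
          (by rw [hw]; simp) hv
        have hl1 : (p ++ s).length + (t.length + 1) = p.length + (s ++ v :: t).length := by
          simp; omega
        rw [hl1, List.length_append] at hnext
        obtain ⟨ls₁, h₁⟩ := ihl.1 t (p ++ s ++ [v]) (v :: q) hl (by rw [hw]; simp)
          (by
            intro x hx hx'
            have hxv : x ≠ v := fun h => hv (h ▸ hx)
            simp only [List.mem_append, List.mem_singleton] at hx'
            rcases hx' with (hx' | hx') | rfl
            · exact (hpq x (by simp [hx]) hxv).1 hx'
            · exact hst hx' hx
            · exact hv hx)
          (by
            intro x hx hx'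
            have hxv : x ≠ v := fun h => hv (h ▸ hx)
            rcases List.mem_cons.mp hx' with hx' | hx'
            · exact hxv hx'
            · exact (hpq x (by simp [hx]) hxv).2 hx')
          (gapHalf w.length (p.length + s.length + 1)) [] []
          (by
            have := HalfEdgeMap.Sons.nil (M := dualMap P) (gapHalf w.length (p.length + s.length + 1))
            rw [dualMap_σ_gapHalf P hnext] at this
            rw [List.length_append] at this
            convert this using 2; simp; omega)
          (fun x hx hx' => gapHalf_ne (by simp at hx'; omega) (by omega) (by simp at hx; omega))
        rw [show (p ++ s ++ [v]).length = p.length + s.length + 1 by simp; omega,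
          ← dualMap_α_partHalf P hk] at h₁
        rw [dualMap_σ_partHalf P hnext] at hts
        have h₂ := HalfEdgeMap.Sons.snoc hts (hh _ (by omega) (by simp)) h₁
        obtain ⟨ls₂, h₃⟩ := ihr.2 s p (t ++ v :: q) v hr hw'
          (fun x hx hxv => by
            have := hpq x (by simp [hx]) hxv
            refine ⟨this.1, ?_⟩
            simp only [List.mem_append, List.mem_cons, not_or]
            exact ⟨fun h => hst hx h, hxv, this.2⟩) h _ _ h₂
          (fun x hx hx' => hh x hx (by simp; omega))
        refine ⟨ls₂, ?_⟩
        rw [contractedSons_right_node]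
        simpa using h₃

/-- One word encodes both `B`, by its chains, and `P`, by its equal letters. Non-crossing passes
from the word to `P`, and the turn around the infinite anti-part, started at the root gap, describes
the dual tree. -/
theorem ChainLabels.isTheta {V : Type*} {m : ℕ} {w : List V} (hm : w.length = m)
    {P : Setoid (Fin m)} {B : BinTree Unit} (hB : ChainLabels none B w)
    (hP : ∀ i j : Fin m, P i j ↔ w[i] = w[j]) : IsTheta B P := by
  subst hm
  refine ⟨fun a b c d hab hbc hcd hac hbd => ?_, dualMap_connected P, ?_⟩
  · rw [hP] at hac hbd ⊢
    simp only [Fin.getElem_fin] at hac hbd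
    have hnc : NonCrossingList w := by simpa using hB.nonCrossing
    refine hnc _ _ ?_
    have := List.map_getElem_sublist (l := w) (is := [a, b, c, d])
      (by simp; omega)
    simpa [← hac, ← hbd] using this
  · obtain ⟨ls, h⟩ := (ChainLabels.sons_dualMap hP B).1 w [] [] hB (by simp) (by simp) (by simp)
      (gapHalf w.length 0) [] [] (by
        have := HalfEdgeMap.Sons.nil (M := dualMap P) (gapHalf w.length 0)
        rw [dualMap_σ_gapHalf_zero] at this
        simpa using this)
      (fun x hx hx' => gapHalf_ne (by simpa using hx') (Nat.zero_le _) (by simp at hx; omega))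
    have := h.describes
    rwa [List.nil_append, ← contractedSons_root] at this

/-! ### Existence and uniqueness for `Θ` -/

theorem IsNonCrossing.exists_chainLabels {m : ℕ} {P : Setoid (Fin m)} (hP : IsNonCrossing P) :
    ∃ (w : List (Quotient P)) (hm : w.length = m) (B : BinTree Unit), ChainLabels none B w ∧
      ∀ i j : Fin m, P i j ↔ w[i] = w[j] := by
  have hw : ∀ i j : Fin m, P i j ↔ (Quotient.mk P i = Quotient.mk P j) :=
    fun i j => (Quotient.eq (r := P)).symm
  refine ⟨List.ofFn (Quotient.mk P), by simp, ?_⟩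
  have hnc : NonCrossingList (List.ofFn (Quotient.mk P)) := by
    intro a b hab
    obtain ⟨is, his, hlt⟩ := List.sublist_eq_map_getElem hab
    rcases is with _ | ⟨i, _ | ⟨j, _ | ⟨k, _ | ⟨l, _ | ⟨x, is⟩⟩⟩⟩⟩ <;> simp at his
    simp only [List.pairwise_cons, List.mem_cons] at hlt
    obtain ⟨rfl, rfl, h1, h2⟩ := his
    rw [← hw]
    refine hP _ _ (k.cast (by simp)) (l.cast (by simp)) ?_ ?_ ?_ ((hw _ _).2 h1) ((hw _ _).2 h2)
    · exact hlt.1 _ (by simp)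
    · exact hlt.2.1 _ (by simp)
    · exact hlt.2.2.1 _ (by simp)
  obtain ⟨B, hB⟩ := hnc.exists_chainLabels _ none (by simp)
  exact ⟨B, hB, by simpa using hw⟩

/-- Labels other than that of the father are taken from `n` upwards. Choosing the bound for the left
subtree above everything used in the right subtree keeps different chains apart. -/
theorem exists_chainLabels_nat (B : BinTree Unit) (o : Option ℕ) (n : ℕ) (hn : ∀ v ∈ o, v < n) :
    ∃ s : List ℕ, ChainLabels o B s ∧ ∀ x ∈ s, x ∈ o ∨ n ≤ x := by
  induction B generalizing o n with
  | leaf x => exact ⟨[], .leaf _ _, by simp⟩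
  | node l r ihl ihr =>
    obtain ⟨v, hov, hvn⟩ : ∃ v, (∀ w ∈ o, w = v) ∧ (v ∈ o ∨ n ≤ v) := by
      cases o with
      | none => exact ⟨n, by simp, by simp⟩
      | some v => exact ⟨v, by simp, by simp⟩
    obtain ⟨s, hs, hs'⟩ := ihr (some v) (max n (v + 1)) (by simp)
    obtain ⟨b, hb⟩ : ∃ b, ∀ x ∈ s, x < b :=
      ⟨s.sum + 1, fun x hx => Nat.lt_succ_of_le (List.single_le_sum (by simp) x hx)⟩
    obtain ⟨t, ht, ht'⟩ := ihl none (max (max n (v + 1)) b) (by simp)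
    refine ⟨s ++ v :: t, .node hov hs ht ?_ ?_, ?_⟩
    · intro h
      have := ht' v h
      simp at this
    · intro x hx hx'
      have h1 := ht' x hx'
      have h2 := hb x hx
      simp at h1
      omega
    · intro x hx
      simp only [List.mem_append, List.mem_cons] at hx
      rcases hx with hx | rfl | hx
      · rcases hs' x hx with h | h
        · simp at h; subst h; exact hvn
        · right; omega
      · exact hvn
      · right
        have := ht' x hx
        simp at this; omega

theorem IsNonCrossing.exists_isTheta {m : ℕ} {P : Setoid (Fin m)} (hP : IsNonCrossing P) :
    ∃ B : BinTree Unit, B.size = m ∧ IsTheta B P := by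
  obtain ⟨w, hm, B, hB, hw⟩ := hP.exists_chainLabels
  exact ⟨B, by rw [hB.size_eq, hm], hB.isTheta hm hw⟩

theorem IsTheta.binTree_unique {m : ℕ} {P : Setoid (Fin m)} {B B' : BinTree Unit}
    (h : IsTheta B P) (h' : IsTheta B' P) : B = B' :=
  theta_injective (h.2.2.unique h'.2.2)

/-- Two labellings of the same binary tree have the same pairs of equal labels. -/
theorem ChainLabels.eq_iff_eq {A : Type} {V V' : Type*} {B : BinTree A} {o : Option V} {s : List V}
    (h : ChainLabels o B s) {o' : Option V'} {s' : List V'} (h' : ChainLabels o' B s')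
    (ho : o.isSome = o'.isSome) :
    ∀ p ∈ (o.toList ++ s).zip (o'.toList ++ s'), ∀ q ∈ (o.toList ++ s).zip (o'.toList ++ s'),
      p.1 = q.1 ↔ p.2 = q.2 := by
  induction h generalizing o' s' with
  | leaf o x =>
    cases h'
    rcases o with _ | v <;> rcases o' with _ | v' <;> simp_all
  | @node o v l r s t hov hr hl hv hd ih1 ih2 =>
    cases h' with
    | @node _ v' _ _ s' t' hov' hr' hl' hv' hd' =>
      have ih1 := ih1 hr' rfl
      have ih2 := ih2 hl' rfl
      have hlen : s.length = s'.length := by rw [← hr.size_eq, ← hr'.size_eq]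
      -- The pairs split into those of the chain of `v` with the right subtree and those of the left
      -- subtree. Labels never agree across this division, on either side, so the induction
      -- hypotheses suffice.
      have hz : ∀ p ∈ (o.toList ++ (s ++ v :: t)).zip (o'.toList ++ (s' ++ v' :: t')),
          p ∈ (v :: s).zip (v' :: s') ∨ p ∈ t.zip t' := by
        have key : ∀ p ∈ (s ++ v :: t).zip (s' ++ v' :: t'),
            p ∈ (v :: s).zip (v' :: s') ∨ p ∈ t.zip t' := by
          intro p hp
          rw [List.zip_append hlen] at hp
          simp only [List.mem_append, List.zip_cons_cons, List.mem_cons] at hp ⊢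
          tauto
        rcases o with _ | w <;> rcases o' with _ | w'
        · simpa using key
        · simp at ho
        · simp at ho
        · obtain rfl := hov w rfl
          obtain rfl := hov' w' rfl
          intro p hp
          simp only [Option.toList_some, List.singleton_append, List.zip_cons_cons,
            List.mem_cons] at hp
          rcases hp with rfl | hp
          · simp
          · exact key p hp
      have hvs : ∀ p ∈ (v :: s).zip (v' :: s'), ∀ q ∈ t.zip t', p.1 ≠ q.1 ∧ p.2 ≠ q.2 := by
        rintro ⟨p, p'⟩ hp ⟨q, q'⟩ hq
        obtain ⟨hp1, hp2⟩ := List.of_mem_zip hp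
        obtain ⟨hq1, hq2⟩ := List.of_mem_zip hq
        constructor
        · rintro rfl
          rcases List.mem_cons.mp hp1 with h | h
          · exact hv (h ▸ hq1)
          · exact hd h hq1
        · rintro rfl
          rcases List.mem_cons.mp hp2 with h | h
          · exact hv' (h ▸ hq2)
          · exact hd' h hq2
      intro p hp q hq
      rcases hz p hp with hp | hp <;> rcases hz q hq with hq | hq
      · exact ih1 p (by simpa using hp) q (by simpa using hq)
      · exact iff_of_false (hvs p hp q hq).1 (hvs p hp q hq).2
      · exact iff_of_false (hvs q hq p hp).1.symm (hvs q hq p hp).2.symm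
      · exact ih2 p (by simpa using hp) q (by simpa using hq)

/-- The partition is not rebuilt from its dual tree. Each of `P` and `P'` comes from a word
labelling some binary tree; both binary trees equal `B` by `IsTheta.binTree_unique`, and two
labellings of `B` have the same coincidences. -/
theorem IsTheta.partition_unique {m : ℕ} {P P' : Setoid (Fin m)} {B : BinTree Unit}
    (h : IsTheta B P) (h' : IsTheta B P') : P = P' := by
  obtain ⟨w, hm, B₁, hB, hw⟩ := h.1.exists_chainLabels
  obtain ⟨w', hm', B₂, hB', hw'⟩ := h'.1.exists_chainLabels
  obtain rfl := h.binTree_unique (hB.isTheta hm hw)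
  obtain rfl := h'.binTree_unique (hB'.isTheta hm' hw')
  have key := hB.eq_iff_eq hB' rfl
  have hmem (i : Fin m) : (w[i], w'[i]) ∈ w.zip w' := by
    rw [List.mem_iff_getElem]
    exact ⟨i, by simp [hm, hm'], by simp⟩
  ext i j
  rw [hw, hw']
  exact key _ (by simpa using hmem i) _ (by simpa using hmem j)

theorem BinTree.exists_isTheta {m : ℕ} {B : BinTree Unit} (hB : B.size = m) :
    ∃ P : Setoid (Fin m), IsTheta B P := by
  obtain ⟨s, hs, -⟩ := exists_chainLabels_nat B none 0 (by simp)
  have hm : s.length = m := by rw [← hs.size_eq, hB]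
  exact ⟨Setoid.comap (fun i : Fin m => s[i]) ⊥, hs.isTheta hm fun i j => Iff.rfl⟩

/-! ### Maps with a single face -/

namespace HalfEdgeMap

variable {H : Type*}

/-- The half-edge at which the border is after `k` steps. -/
def border (M : HalfEdgeMap H) (k : ℕ) : H := (M.face ^ k) M.root

theorem face_apply (M : HalfEdgeMap H) (x : H) : M.face x = M.σ (M.α x) := rfl

theorem border_succ (M : HalfEdgeMap H) (k : ℕ) : M.border (k + 1) = M.face (M.border k) := by
  rw [border, pow_succ', Equiv.Perm.mul_apply, border]

section Border

variable (M : HalfEdgeMap H)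

theorem sameCycle_face_root (hM : M.faceCount = 1) (x : H) : M.face.SameCycle M.root x := by
  have := (Nat.card_eq_one_iff_unique.mp hM).1
  have h : (Quotient.mk (Equiv.Perm.SameCycle.setoid M.face) M.root) = Quotient.mk _ x :=
    Subsingleton.elim _ _
  exact Quotient.exact h

theorem time_border_le (k : ℕ) : M.time (M.border k) ≤ k := Nat.sInf_le rfl

theorem time_root : M.time M.root = 0 := Nat.le_zero.mp (M.time_border_le 0)

variable [Finite H]

theorem minimalPeriod_face_root (hM : M.faceCount = 1) :
    Function.minimalPeriod M.face M.root = Nat.card H := by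
  have hpos : 0 < Function.minimalPeriod M.face M.root :=
    Function.minimalPeriod_pos_of_mem_periodicPts
      (Function.Injective.mem_periodicPts M.face.injective M.root)
  have hb : Function.Bijective
      (fun k : Fin (Function.minimalPeriod M.face M.root) => M.border k) := by
    constructor
    · intro k l hkl
      have := Function.iterate_injOn_Iio_minimalPeriod (f := M.face) (x := M.root)
        (Set.mem_Iio.mpr k.2) (Set.mem_Iio.mpr l.2)
      simp only [Equiv.Perm.iterate_eq_pow] at this
      exact Fin.ext (this hkl)
    · intro x
      obtain ⟨n, hn⟩ := (M.sameCycle_face_root hM x).exists_nat_pow_eq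
      refine ⟨⟨n % _, Nat.mod_lt n hpos⟩, ?_⟩
      have := Function.iterate_mod_minimalPeriod_eq (f := M.face) (x := M.root) (n := n)
      simp only [Equiv.Perm.iterate_eq_pow] at this
      exact this.trans hn
  simpa using Nat.card_eq_of_bijective _ hb

theorem border_time (hM : M.faceCount = 1) (x : H) : M.border (M.time x) = x :=
  Nat.sInf_mem (s := {k : ℕ | (M.face ^ k) M.root = x})
    (M.sameCycle_face_root hM x).exists_nat_pow_eq

theorem border_card (hM : M.faceCount = 1) : M.border (Nat.card H) = M.root := by
  have := Function.iterate_minimalPeriod (f := M.face) (x := M.root)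
  rwa [M.minimalPeriod_face_root hM, Equiv.Perm.iterate_eq_pow] at this

theorem border_injOn (hM : M.faceCount = 1) {k l : ℕ} (hk : k < Nat.card H) (hl : l < Nat.card H)
    (h : M.border k = M.border l) : k = l := by
  have := Function.iterate_injOn_Iio_minimalPeriod (f := M.face) (x := M.root)
  rw [M.minimalPeriod_face_root hM] at this
  refine this (Set.mem_Iio.mpr hk) (Set.mem_Iio.mpr hl) ?_
  simpa only [Equiv.Perm.iterate_eq_pow, border] using h

theorem time_border (hM : M.faceCount = 1) {k : ℕ} (hk : k < Nat.card H) :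
    M.time (M.border k) = k :=
  M.border_injOn hM ((M.time_border_le k).trans_lt hk) hk (M.border_time hM _)

theorem time_lt (hM : M.faceCount = 1) (x : H) : M.time x < Nat.card H := by
  obtain ⟨n, hn⟩ := (M.sameCycle_face_root hM x).exists_nat_pow_eq
  have h0 : 0 < Nat.card H := Nat.card_pos_iff.mpr ⟨⟨x⟩, inferInstance⟩
  have h1 := Function.iterate_mod_minimalPeriod_eq (f := M.face) (x := M.root) (n := n)
  rw [M.minimalPeriod_face_root hM] at h1
  simp only [Equiv.Perm.iterate_eq_pow] at h1
  exact (Nat.sInf_le (h1.trans hn)).trans_lt (Nat.mod_lt n h0)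

theorem time_inj (hM : M.faceCount = 1) {x y : H} (h : M.time x = M.time y) : x = y := by
  rw [← M.border_time hM x, h, M.border_time hM y]

/-- An involution moves twice as many points as it moves forward in time. -/
theorem ncard_moved (hM : M.faceCount = 1) {t : H → H} (ht : Function.Involutive t) :
    {x | t x ≠ x}.ncard = 2 * {x | M.time x < M.time (t x)}.ncard := by
  have h1 : {x | t x ≠ x} =
      {x | M.time x < M.time (t x)} ∪ t '' {x | M.time x < M.time (t x)} := by
    ext x
    simp only [Set.mem_ofPred_eq, Set.mem_union, Set.mem_image]
    constructor
    · intro h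
      rcases lt_trichotomy (M.time x) (M.time (t x)) with h1 | h1 | h1
      · exact .inl h1
      · exact absurd (M.time_inj hM h1).symm h
      · exact .inr ⟨t x, by rwa [ht], ht x⟩
    · rintro (h | ⟨y, h, rfl⟩) h2
      · rw [h2] at h; exact lt_irrefl _ h
      · rw [ht] at h2; rw [← h2] at h; exact lt_irrefl _ h
  rw [h1, Set.ncard_union_eq, Set.ncard_image_of_injective _ ht.injective, two_mul]
  rw [Set.disjoint_left]
  rintro _ h ⟨y, hy, rfl⟩
  simp only [Set.mem_ofPred_eq, ht y] at h hy
  omega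

/-- If an involution with `k` transpositions cuts the single face into `k + 1` cycles, then the
transpositions do not cross along the border. -/
theorem not_crossing (hM : M.faceCount = 1) {t : H → H} (ht : Function.Involutive t)
    (hcard : 2 * Nat.card (Quotient (Equiv.Perm.SameCycle.setoid (ht.toPerm.trans M.face))) =
      {x | t x ≠ x}.ncard + 2) {x y : H} (h1 : M.time x < M.time y)
    (h2 : M.time y < M.time (t x)) (h3 : M.time (t x) < M.time (t y)) : False := by
  set g := ht.toPerm.trans M.face with hg
  let q : H → Quotient (Equiv.Perm.SameCycle.setoid g) := Quotient.mk _
  have hq (z : H) : q (M.face z) = q (t z) := by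
    refine Quotient.sound ?_
    have : M.face z = g (t z) := by simp [hg, ht z]
    rw [this]
    exact Equiv.Perm.sameCycle_apply_left.mpr (Equiv.Perm.SameCycle.refl _ _)
  -- The vertices of `G` are the cycles of `g`. Each of the `k` transpositions except that of `x`
  -- contributes at most one edge, so `G` has at most `k - 1` edges on `k + 1` vertices and cannot
  -- be connected.
  let U : Set H := {z | M.time z < M.time (t z)} \ {x}
  let G : SimpleGraph (Quotient (Equiv.Perm.SameCycle.setoid g)) :=
    SimpleGraph.fromEdgeSet ((fun z => s(q z, q (t z))) '' U)
  have hU : U.ncard + 1 = {z | M.time z < M.time (t z)}.ncard :=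
    Set.ncard_sdiff_singleton_add_one (show M.time x < M.time (t x) by omega)
  have hE : Nat.card G.edgeSet ≤ U.ncard := by
    rw [Nat.card_coe_set_eq, SimpleGraph.edgeSet_fromEdgeSet]
    exact (Set.ncard_le_ncard Set.sdiff_subset).trans Set.ncard_image_le
  have hadj (z : H) (hz : z ∈ U) : G.Reachable (q z) (q (t z)) := by
    by_cases heq : q z = q (t z)
    · rw [heq]
    · exact SimpleGraph.Adj.reachable ((SimpleGraph.fromEdgeSet_adj _).mpr ⟨⟨z, hz, rfl⟩, heq⟩)
  have hreach (z : H) (hzx : z ≠ x) (hzy : z ≠ t x) : G.Reachable (q z) (q (t z)) := by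
    rcases lt_trichotomy (M.time z) (M.time (t z)) with h | h | h
    · exact hadj z ⟨h, hzx⟩
    · rw [← M.time_inj hM h]
    · have := hadj (t z) ⟨by simpa [ht z] using h, fun h => hzy (by rw [← h, ht])⟩
      rw [ht z] at this
      exact this.symm
  have hstep (k : ℕ) (hk : k < Nat.card H) (h : k ≠ M.time x) (h' : k ≠ M.time (t x)) :
      G.Reachable (q (M.border k)) (q (M.border (k + 1))) := by
    rw [M.border_succ, hq]
    exact hreach _ (fun e => h (by rw [← e, M.time_border hM hk]))
      (fun e => h' (by rw [← e, M.time_border hM hk]))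
  have hchain (k l : ℕ) (hkl : k ≤ l) (hl : l ≤ Nat.card H)
      (h : ∀ j, k ≤ j → j < l → j ≠ M.time x ∧ j ≠ M.time (t x)) :
      G.Reachable (q (M.border k)) (q (M.border l)) := by
    induction l, hkl using Nat.le_induction with
    | base => exact .refl _
    | succ l hkl ih =>
      have := h l hkl (Nat.lt_succ_self l)
      exact (ih (by omega) fun j h1 h2 => h j h1 (by omega)).trans (hstep l hl this.1 this.2)
  have htx := M.time_lt hM (t x)
  have hty := M.time_lt hM (t y)
  have hyty : G.Reachable (q y) (q (t y)) :=
    hreach y (fun h => by rw [h] at h1; omega) (fun h => by rw [h] at h2; omega)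
  -- Without the steps that follow `x` and `t x`, the border consists of two arcs. A crossing puts
  -- `y` on one and `t y` on the other, so the edge of `y` makes up for the missing edge of `x`.
  have hall (z : H) : G.Reachable (q z) (q y) := by
    have hz := M.time_lt hM z
    rw [← M.border_time hM z]
    by_cases hz1 : M.time x < M.time z ∧ M.time z ≤ M.time (t x)
    · refine SimpleGraph.Reachable.trans ?_ ((hchain (M.time z) (M.time (t x)) hz1.2 htx.le
        fun j h1 h2 => ⟨by omega, by omega⟩).trans (hchain (M.time y) (M.time (t x)) h2.le htx.le
        fun j h1 h2 => ⟨by omega, by omega⟩).symm)  |>.trans (by rw [M.border_time hM])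
      exact .refl _
    · refine SimpleGraph.Reachable.trans ?_ hyty.symm
      have hty' : G.Reachable (q (t y)) (q M.root) := by
        have := hchain (M.time (t y)) (Nat.card H) hty.le le_rfl
          fun j h1 h2 => ⟨by omega, by omega⟩
        rwa [M.border_card hM, M.border_time hM] at this
      refine SimpleGraph.Reachable.trans ?_ hty'.symm
      rcases Nat.lt_or_ge (M.time x) (M.time z) with h | h
      · have := hchain (M.time z) (Nat.card H) hz.le le_rfl
          fun j h1 h2 => ⟨by omega, by omega⟩
        rwa [M.border_card hM] at this
      · exact (hchain 0 (M.time z) (Nat.zero_le _) hz.le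
          fun j h1 h2 => ⟨by omega, by omega⟩).symm
  have hconn : G.Connected := by
    have : Nonempty (Quotient (Equiv.Perm.SameCycle.setoid g)) := ⟨q x⟩
    refine ⟨fun a b => ?_⟩
    induction a using Quotient.inductionOn
    induction b using Quotient.inductionOn
    exact (hall _).trans (hall _).symm
  have := hconn.card_vert_le_card_edgeSet_add_one
  rw [M.ncard_moved hM ht] at hcard
  omega

end Border

/-! ### The tour of a spanning tree -/

section Tour

variable (M : HalfEdgeMap H) (T : Set H)

theorem restrict_α_of_mem (hT : M.IsSpanningTree T) {x : H} (hx : x ∈ T) :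
    (M.restrict T).α x = M.α x := by simp [restrict, hx, hT.2.1 x hx]

theorem restrict_α_of_notMem {x : H} (hx : x ∉ T) : (M.restrict T).α x = x := by
  simp [restrict, hx]

theorem α_mem_iff (hT : M.IsSpanningTree T) (x : H) : M.α x ∈ T ↔ x ∈ T :=
  ⟨fun h => by have := hT.2.1 _ h; rwa [M.α_invol] at this, hT.2.1 x⟩

theorem α_ne (hM : M.IsRootedMap) {x : H} (hx : x ≠ M.root) : M.α x ≠ x :=
  fun h => hx (hM.2 x h)

variable [Finite H]

theorem size_eq_ncard {R : HalfEdgeMap H} (hR : R.faceCount = 1) {t : H → H}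
    (ht : Function.Involutive t) : Nat.card {h // t h ≠ h} / 2 =
      {x | R.time x < R.time (t x)}.ncard := by
  have h1 := R.ncard_moved hR ht
  have : Nat.card {h // t h ≠ h} = {x | t x ≠ x}.ncard := rfl
  omega

theorem card_eq (hM : M.IsRootedMap) (hT : M.IsSpanningTree T) :
    Nat.card H = 2 * M.size + 1 := by
  have h1 := (M.restrict T).ncard_moved hT.2.2.2 M.α_invol
  have h2 : {x | M.α x ≠ x} = {M.root}ᶜ := by
    ext x
    simp only [Set.mem_ofPred_eq, Set.mem_compl_iff, Set.mem_singleton_iff]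
    exact ⟨fun h h' => h (by rw [h', M.α_root]), M.α_ne hM⟩
  have h3 := Set.ncard_add_ncard_compl ({M.root} : Set H)
  rw [← h2, Set.ncard_singleton] at h3
  rw [size, size_eq_ncard hT.2.2.2 M.α_invol]
  omega

/-- The edges of the tree do not cross each other, and neither do the other edges. -/
theorem not_crossing_of_spanningTree (hM : M.IsRootedMap) (hT : M.IsSpanningTree T) {x y : H}
    (hxy : x ∈ T ↔ y ∈ T) (h1 : (M.restrict T).time x < (M.restrict T).time y)
    (h2 : (M.restrict T).time y < (M.restrict T).time (M.α x))
    (h3 : (M.restrict T).time (M.α x) < (M.restrict T).time (M.α y)) : False := by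
  classical
  have hf := hT.2.2.2
  have e1 := hT.2.2.1.2
  have e2 := hM.1.2
  have e3 : (M.restrict T).vertexCount = M.vertexCount := rfl
  have c1 := (M.restrict T).ncard_moved hf (M.restrict T).α_invol
  have c2 : {x | (M.restrict T).α x ≠ x} = T := by
    ext z
    simp only [Set.mem_ofPred_eq]
    constructor
    · intro h
      by_contra hz
      exact h (M.restrict_α_of_notMem T hz)
    · intro hz
      rw [M.restrict_α_of_mem T hT hz]
      exact M.α_ne hM fun h => hT.1 (h ▸ hz)
  have c3 : (M.restrict T).size = {x | (M.restrict T).time x <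
      (M.restrict T).time ((M.restrict T).α x)}.ncard :=
    size_eq_ncard hf (M.restrict T).α_invol
  by_cases hx : x ∈ T
  · have hy := hxy.mp hx
    -- Composing the border with the edges of `T` gives `σ`, whose cycles are the vertices: one more
    -- than the edges of the tree.
    refine (M.restrict T).not_crossing hf (M.restrict T).α_invol (x := x) (y := y) ?_ h1 ?_ ?_
    · have : (M.restrict T).α_invol.toPerm.trans (M.restrict T).face = M.σ := by
        ext z
        simp only [Equiv.trans_apply, Function.Involutive.coe_toPerm, face_apply,
          (M.restrict T).α_invol z]
        rfl
      rw [this]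
      have : Nat.card (Quotient (Equiv.Perm.SameCycle.setoid M.σ)) = M.vertexCount := rfl
      omega
    · rwa [M.restrict_α_of_mem T hT hx]
    · rwa [M.restrict_α_of_mem T hT hx, M.restrict_α_of_mem T hT hy]
  · have hy : y ∉ T := fun h => hx (hxy.mpr h)
    let t : H → H := fun z => if z ∈ T then z else M.α z
    have ht : Function.Involutive t := by
      intro z
      by_cases hz : z ∈ T
      · simp [t, hz]
      · simp [t, hz, M.α_mem_iff T hT, M.α_invol z]
    -- Composing the border with the edges outside `T` gives the faces of `M`. Euler's formula for
    -- `M` and for the tree leaves one more face than there are edges outside `T`.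
    refine (M.restrict T).not_crossing hf ht (x := x) (y := y) ?_ h1 ?_ ?_
    · have : ht.toPerm.trans (M.restrict T).face = M.face := by
        ext z
        simp only [Equiv.trans_apply, Function.Involutive.coe_toPerm, face_apply, t]
        by_cases hz : z ∈ T
        · simp only [hz, if_true, M.restrict_α_of_mem T hT hz]
          rfl
        · have : M.α z ∉ T := by rwa [M.α_mem_iff T hT]
          simp only [hz, if_false, M.restrict_α_of_notMem T this]
          rfl
      rw [this]
      have hc : Nat.card (Quotient (Equiv.Perm.SameCycle.setoid M.face)) = M.faceCount := rfl
      have c4 : {z | t z ≠ z} = (insert M.root T)ᶜ := by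
        ext z
        simp only [Set.mem_ofPred_eq, Set.mem_compl_iff, Set.mem_insert_iff, not_or, t]
        by_cases hz : z ∈ T
        · simp [hz]
        · simp only [hz, if_false, not_false_eq_true, and_true]
          exact ⟨fun h h' => h (by rw [h', M.α_root]), M.α_ne hM⟩
      have c5 := Set.ncard_add_ncard_compl (insert M.root T)
      rw [Set.ncard_insert_of_notMem hT.1, M.card_eq T hM hT] at c5
      rw [c2] at c1
      rw [c4]
      omega
    · simpa [t, hx] using h2
    · simpa only [t, hx, hy, if_false] using h3

theorem σ_α_of_mem (hT : M.IsSpanningTree T) {x : H} (hx : x ∈ T) :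
    M.σ (M.α x) = (M.restrict T).border ((M.restrict T).time x + 1) := by
  rw [border_succ, (M.restrict T).border_time hT.2.2.2, face_apply, M.restrict_α_of_mem T hT hx]
  rfl

theorem σ_of_notMem (hT : M.IsSpanningTree T) {x : H} (hx : x ∉ T) :
    M.σ x = (M.restrict T).border ((M.restrict T).time x + 1) := by
  rw [border_succ, (M.restrict T).border_time hT.2.2.2, face_apply, M.restrict_α_of_notMem T hx]
  rfl

/-- The part of the border between the two halves of an edge of the tree is closed under `σ`. -/
theorem σ_mem_segment (hM : M.IsRootedMap) (hT : M.IsSpanningTree T) {x y : H} (hx : x ∈ T)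
    (h1 : (M.restrict T).time x < (M.restrict T).time y)
    (h2 : (M.restrict T).time y ≤ (M.restrict T).time (M.α x)) :
    (M.restrict T).time x < (M.restrict T).time (M.σ y) ∧
      (M.restrict T).time (M.σ y) ≤ (M.restrict T).time (M.α x) := by
  have hf := hT.2.2.2
  have hlt (z : H) : (M.restrict T).time z < Nat.card H := (M.restrict T).time_lt hf z
  have hxy : y ≠ x := fun h => by rw [h] at h1; omega
  by_cases hy : y ∈ T
  · have hy' : M.α y ∈ T := hT.2.1 y hy
    have hσ := M.σ_α_of_mem T hT hy'
    rw [M.α_invol] at hσ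
    rw [hσ]
    -- On the border `σ y` comes just after `α y`. If `y` ends the segment, this is the moment after
    -- `x`. Otherwise `α y` also lies in the segment, before its end, since edges of `T` do not
    -- cross.
    by_cases hyx : y = M.α x
    · rw [hyx, M.α_invol]
      have := hlt (M.α x)
      rw [(M.restrict T).time_border hf (by omega)]
      rw [hyx] at h1
      omega
    · have hne : (M.restrict T).time y ≠ (M.restrict T).time (M.α x) := fun h => hyx ((M.restrict T).time_inj hf h)
      have hne2 : M.α y ≠ x := fun h => hyx (by rw [← h, M.α_invol])
      have hne3 : (M.restrict T).time (M.α y) ≠ (M.restrict T).time x := fun h => hne2 ((M.restrict T).time_inj hf h)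
      have hne4 : (M.restrict T).time (M.α y) ≠ (M.restrict T).time (M.α x) :=
        fun h => hxy (M.α_invol.injective ((M.restrict T).time_inj hf h))
      have h3 : (M.restrict T).time (M.α y) < (M.restrict T).time (M.α x) := by
        by_contra h
        exact M.not_crossing_of_spanningTree T hM hT (x := x) (y := y) (by simp [hx, hy]) h1
          (by omega) (by omega)
      have h4 : (M.restrict T).time x < (M.restrict T).time (M.α y) := by
        by_contra h
        exact M.not_crossing_of_spanningTree T hM hT (x := M.α y) (y := x) (by simp [hx, hy'])
          (by omega) (by rw [M.α_invol]; omega) (by rw [M.α_invol]; omega)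
      have := hlt (M.α x)
      rw [(M.restrict T).time_border hf (by omega)]
      omega
  · rw [M.σ_of_notMem T hT hy]
    have hne : (M.restrict T).time y ≠ (M.restrict T).time (M.α x) := fun h =>
      hy (by rw [(M.restrict T).time_inj hf h]; exact hT.2.1 x hx)
    have := hlt (M.α x)
    rw [(M.restrict T).time_border hf (by omega)]
    omega

theorem sameCycle_mem_segment (hM : M.IsRootedMap) (hT : M.IsSpanningTree T) {x y z : H}
    (hx : x ∈ T) (h1 : (M.restrict T).time x < (M.restrict T).time y)
    (h2 : (M.restrict T).time y ≤ (M.restrict T).time (M.α x)) (hz : M.σ.SameCycle y z) :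
    (M.restrict T).time x < (M.restrict T).time z ∧
      (M.restrict T).time z ≤ (M.restrict T).time (M.α x) := by
  obtain ⟨n, rfl⟩ := hz.exists_nat_pow_eq
  induction n with
  | zero => exact ⟨h1, h2⟩
  | succ n ih =>
    rw [pow_succ', Equiv.Perm.mul_apply]
    have := ih ⟨n, rfl⟩
    exact M.σ_mem_segment T hM hT hx this.1 this.2

/-- The half-edges met after `x` and up to `α x` are closed under `σ` and under all edges of `T`
except that of `x`, in both directions. They include `α x` but not the root. -/
theorem not_reach_of_time_lt (hM : M.IsRootedMap) (hT : M.IsSpanningTree T) {x : H} (hx : x ∈ T)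
    (h : (M.restrict T).time x < (M.restrict T).time (M.α x)) :
    ¬ (M.restrict (T \ {M.α x, x})).Reach M.root (M.α x) := by
  have hf := hT.2.2.2
  have hinv : ∀ y z, (M.restrict (T \ {M.α x, x})).Reach y z →
      (((M.restrict T).time x < (M.restrict T).time y ∧ (M.restrict T).time y ≤ (M.restrict T).time (M.α x)) ↔ ((M.restrict T).time x < (M.restrict T).time z ∧ (M.restrict T).time z ≤ (M.restrict T).time (M.α x))) := by
    intro y z hyz
    induction hyz with
    | refl => rfl
    | symm _ _ _ ih => exact ih.symm
    | trans _ _ _ _ _ ih1 ih2 => exact ih1.trans ih2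
    | rel y z hyz =>
      rcases hyz with rfl | rfl
      · change _ ↔ ((M.restrict T).time x < (M.restrict T).time (M.σ y) ∧ (M.restrict T).time (M.σ y) ≤ (M.restrict T).time (M.α x))
        constructor
        · exact fun h => M.σ_mem_segment T hM hT hx h.1 h.2
        · intro h
          exact M.sameCycle_mem_segment T hM hT hx h.1 h.2
            (Equiv.Perm.sameCycle_apply_left.mpr (Equiv.Perm.SameCycle.refl _ _))
      · by_cases hy : y ∈ T \ {M.α x, x} ∧ M.α y ∈ T \ {M.α x, x}
        · have : (M.restrict (T \ {M.α x, x})).α y = M.α y := by simp only [restrict, hy]; simp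
          rw [this]
          have key : ∀ w, w ∈ T \ {M.α x, x} → M.α w ∈ T \ {M.α x, x} →
              ((M.restrict T).time x < (M.restrict T).time w ∧ (M.restrict T).time w ≤ (M.restrict T).time (M.α x)) → ((M.restrict T).time x < (M.restrict T).time (M.α w) ∧ (M.restrict T).time (M.α w) ≤ (M.restrict T).time (M.α x)) := by
            intro w hw hw' h
            have hwT := hw.1
            have hs := M.σ_mem_segment T hM hT hx h.1 h.2
            have hσ := M.σ_α_of_mem T hT hw'.1
            rw [M.α_invol] at hσ
            rw [hσ] at hs
            have hlt := (M.restrict T).time_lt hf (M.α w)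
            have hle := (M.restrict T).time_border_le ((M.restrict T).time (M.α w) + 1)
            have hne3 : (M.restrict T).time (M.α w) ≠ (M.restrict T).time x := fun h => hw'.2 (by
              simp [(M.restrict T).time_inj hf h])
            rcases Nat.lt_or_ge ((M.restrict T).time (M.α w) + 1) (Nat.card H) with h1 | h1
            · rw [(M.restrict T).time_border hf h1] at hs
              omega
            -- Here the border closes up, so `σ w` would be the root, whose time `0` is outside the
            -- segment.
            · have : (M.restrict T).time (M.α w) + 1 = Nat.card H := by omega
              rw [this, (M.restrict T).border_card hf, (M.restrict T).time_root] at hs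
              omega
          exact ⟨key y hy.1 hy.2, fun h => by
            have := key (M.α y) hy.2 (by rw [M.α_invol]; exact hy.1) h
            rwa [M.α_invol] at this⟩
        · have : (M.restrict (T \ {M.α x, x})).α y = y := by simp only [restrict, hy]; simp
          rw [this]
  intro hr
  have h1 := (hinv _ _ hr).mpr ⟨h, le_rfl⟩
  have h2 : (M.restrict T).time M.root = 0 := (M.restrict T).time_root
  omega

/-- Before it arrives at `x` the tour has used neither half of this edge, so it has remained in the
component of the root after the deletion. -/
theorem reach_of_time_lt (hT : M.IsSpanningTree T) {x : H}
    (h : (M.restrict T).time x < (M.restrict T).time (M.α x)) :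
    (M.restrict (T \ {x, M.α x})).Reach M.root x := by
  have hf := hT.2.2.2
  have key : ∀ k, k ≤ (M.restrict T).time x →
      (M.restrict (T \ {x, M.α x})).Reach M.root ((M.restrict T).border k) := by
    intro k hk
    induction k with
    | zero => exact .refl _
    | succ k ih =>
      refine .trans _ _ _ (ih (by omega)) ?_
      set y := (M.restrict T).border k with hy
      have hlt := (M.restrict T).time_lt hf x
      have hyk : (M.restrict T).time y = k := (M.restrict T).time_border hf (by omega)
      have hα : (M.restrict (T \ {x, M.α x})).α y = (M.restrict T).α y := by
        by_cases hyT : y ∈ T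
        · have h1 : y ∉ ({x, M.α x} : Set H) := by
            intro h'
            rcases h' with h' | h' <;> rw [h'] at hyk <;> omega
          have h2 : M.α y ∉ ({x, M.α x} : Set H) := by
            intro h2
            apply h1
            rcases h2 with h2 | h2
            · right
              rw [Set.mem_singleton_iff, ← h2, M.α_invol]
            · left
              exact M.α_invol.injective h2
          rw [M.restrict_α_of_mem T hT hyT]
          simp only [restrict]
          rw [if_pos ⟨⟨hyT, h1⟩, ⟨hT.2.1 y hyT, h2⟩⟩]
        · rw [M.restrict_α_of_notMem T hyT, M.restrict_α_of_notMem]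
          exact fun h => hyT h.1
      refine .trans _ ((M.restrict T).α y) _ (.rel _ _ (.inr hα.symm)) (.rel _ _ (.inl ?_))
      rw [border_succ, face_apply]
      rfl
  have := key _ le_rfl
  rwa [(M.restrict T).border_time hf] at this

/-- The tour follows an edge of `T` away from the root before it comes back, so the head is the half
met second. From here on, the orientation is used only through the times of the tour. -/
theorem mem_heads_iff (hM : M.IsRootedMap) (hT : M.IsSpanningTree T) (x : H) :
    x ∈ M.heads T ↔ x = M.root ∨
      (x ∈ T ∧ (M.restrict T).time (M.α x) < (M.restrict T).time x) ∨
      (x ∉ T ∧ (M.restrict T).time x < (M.restrict T).time (M.α x)) := by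
  have key : x ∈ T → (¬ (M.restrict (T \ {x, M.α x})).Reach M.root x ↔
      (M.restrict T).time (M.α x) < (M.restrict T).time x) := by
    intro hx
    constructor
    · intro h
      by_contra h'
      have hne : (M.restrict T).time x ≠ (M.restrict T).time (M.α x) := fun h =>
        M.α_ne hM (fun h => hT.1 (h ▸ hx)) ((M.restrict T).time_inj hT.2.2.2 h).symm
      exact h (M.reach_of_time_lt T hT (by omega))
    · intro h
      have := M.not_reach_of_time_lt T hM hT (x := M.α x) (hT.2.1 x hx) (by rwa [M.α_invol])
      rwa [M.α_invol] at this
  simp only [heads, Set.mem_ofPred_eq, Precedes]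
  constructor
  · rintro (h | ⟨h, h'⟩ | h)
    · exact .inl h
    · exact .inr (.inl ⟨h, (key h).mp h'⟩)
    · exact .inr (.inr h)
  · rintro (h | ⟨h, h'⟩ | h)
    · exact .inl h
    · exact .inr (.inl ⟨h, (key h).mpr h'⟩)
    · exact .inr (.inr h)

end Tour

end HalfEdgeMap

namespace HalfEdgeMap

variable {H : Type*}

/-! ### The vertex explosion -/

section Explosion

variable (M : HalfEdgeMap H) (O : Set H)

theorem firstHead_of_mem {x : H} (hx : x ∈ O) : M.firstHead O x = x := by
  have : sInf {k : ℕ | (M.σ ^ k) x ∈ O} = 0 := Nat.le_zero.mp (Nat.sInf_le (by simpa using hx))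
  simp [firstHead, this]

theorem firstHead_mem {x : H} (hx : ∃ k, (M.σ ^ k) x ∈ O) : M.firstHead O x ∈ O :=
  Nat.sInf_mem (s := {k : ℕ | (M.σ ^ k) x ∈ O}) hx

theorem firstHead_σ {x : H} (hx : ∃ k, (M.σ ^ k) x ∈ O) (hxO : x ∉ O) :
    M.firstHead O (M.σ x) = M.firstHead O x := by
  have h0 : ∀ k, (M.σ ^ k) (M.σ x) = (M.σ ^ (k + 1)) x := fun k => by
    rw [pow_succ, Equiv.Perm.mul_apply]
  have h1 : sInf {k : ℕ | (M.σ ^ k) x ∈ O} = sInf {k : ℕ | (M.σ ^ k) (M.σ x) ∈ O} + 1 := by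
    have h2 := Nat.sInf_mem (s := {k : ℕ | (M.σ ^ k) x ∈ O}) hx
    have hpos : sInf {k : ℕ | (M.σ ^ k) x ∈ O} ≠ 0 := by
      intro h
      rw [h] at h2
      exact hxO (by simpa using h2)
    obtain ⟨j, hj⟩ := Nat.exists_eq_succ_of_ne_zero hpos
    rw [hj] at h2
    have h3 : j ∈ {k : ℕ | (M.σ ^ k) (M.σ x) ∈ O} := by
      change (M.σ ^ j) (M.σ x) ∈ O
      rw [h0]; exact h2
    have h4 := Nat.sInf_mem (s := {k : ℕ | (M.σ ^ k) (M.σ x) ∈ O}) ⟨j, h3⟩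
    have h5 := Nat.sInf_le h3
    change (M.σ ^ _) (M.σ x) ∈ O at h4
    rw [h0] at h4
    have h6 : sInf {k : ℕ | (M.σ ^ k) x ∈ O} ≤ _ := Nat.sInf_le h4
    omega
  rw [firstHead, firstHead, h1, h0]

theorem sameCycle_firstHead (x : H) : M.σ.SameCycle x (M.firstHead O x) :=
  Equiv.Perm.sameCycle_pow_right.mpr (.refl _ _)

variable [Finite H]

theorem sameCycle_of_phi0 {x y : H} (h : (M.phi0 O).σ.SameCycle x y) : M.σ.SameCycle x y := by
  obtain ⟨n, rfl⟩ := h.exists_nat_pow_eq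
  induction n with
  | zero => exact .refl _ _
  | succ n ih =>
    rw [pow_succ', Equiv.Perm.mul_apply]
    exact (ih ⟨n, rfl⟩).trans (Equiv.Perm.sameCycle_pow_right.mpr (.refl _ _))

theorem firstHead_phi0_σ (x : H) : M.firstHead O ((M.phi0 O).σ x) = M.firstHead O x :=
  (firstReturn_spec M.σ (M.firstHead O) x).2

theorem firstHead_eq_of_sameCycle {x y : H} (h : (M.phi0 O).σ.SameCycle x y) :
    M.firstHead O x = M.firstHead O y := by
  obtain ⟨n, rfl⟩ := h.exists_nat_pow_eq
  induction n with
  | zero => rfl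
  | succ n ih =>
    rw [pow_succ', Equiv.Perm.mul_apply, firstHead_phi0_σ]
    exact ih ⟨n, rfl⟩

theorem phi0_σ_of_notMem {x : H} (hx : ∃ k, (M.σ ^ k) x ∈ O) (hxO : x ∉ O) :
    (M.phi0 O).σ x = M.σ x :=
  (firstReturn_eq M.σ (M.firstHead O) x 1 one_pos (M.firstHead_σ O hx hxO)
    fun j h1 h2 => by omega)

/-- Let `z` precede `σ y` around the exploded vertex. If `z` were a tail, the explosion would keep
its successor, and `σ z = σ y` would make the head `y` a tail. So `z` is the head of its vertex.
This is how a new exploded vertex starts in the tour. -/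
theorem phi0_σ_firstHead (hO : ∀ x, ∃ k, (M.σ ^ k) x ∈ O) {y : H} (hy : y ∈ O) :
    (M.phi0 O).σ (M.firstHead O (M.σ y)) = M.σ y := by
  set z := (M.phi0 O).σ.symm (M.σ y) with hz
  have hzy : (M.phi0 O).σ z = M.σ y := Equiv.apply_symm_apply _ _
  have h1 : M.firstHead O z = M.firstHead O (M.σ y) := by
    rw [← hzy, firstHead_phi0_σ]
  have hzO : z ∈ O := by
    by_contra h
    rw [M.phi0_σ_of_notMem O (hO z) h] at hzy
    exact h (M.σ.injective hzy ▸ hy)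
  rw [← h1, M.firstHead_of_mem O hzO, hzy]

end Explosion

/-! ### Heads and tails in the tour -/

section Tour

variable (M : HalfEdgeMap H) (T : Set H) [Finite H]

theorem notMem_heads_iff (hM : M.IsRootedMap) (hT : M.IsSpanningTree T) (x : H) :
    x ∉ M.heads T ↔ (x ∈ T ∧ (M.restrict T).time x < (M.restrict T).time (M.α x)) ∨
      (x ∉ T ∧ x ≠ M.root ∧ (M.restrict T).time (M.α x) < (M.restrict T).time x) := by
  rw [M.mem_heads_iff T hM hT]
  by_cases hx : x = M.root
  · have h := hT.1
    rw [← hx] at h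
    simp [hx, hT.1]
  · have hne : (M.restrict T).time x ≠ (M.restrict T).time (M.α x) := fun h =>
      M.α_ne hM hx ((M.restrict T).time_inj hT.2.2.2 h).symm
    by_cases hxT : x ∈ T
    · simp [hx, hxT]; omega
    · simp [hx, hxT]; omega

theorem α_mem_heads (hM : M.IsRootedMap) (hT : M.IsSpanningTree T) {x : H}
    (hx : x ∉ M.heads T) : M.α x ∈ M.heads T := by
  rw [notMem_heads_iff M T hM hT] at hx
  rw [mem_heads_iff M T hM hT, M.α_mem_iff T hT, M.α_invol]
  tauto

theorem α_notMem_heads (hM : M.IsRootedMap) (hT : M.IsSpanningTree T) {x : H}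
    (hx : x ∈ M.heads T) (hr : x ≠ M.root) : M.α x ∉ M.heads T := by
  rw [notMem_heads_iff M T hM hT, M.α_mem_iff T hT, M.α_invol]
  rw [mem_heads_iff M T hM hT] at hx
  have : M.α x ≠ M.root := fun h => hr (by rw [← M.α_invol x, h, M.α_root])
  tauto

/-- On the border `σ x` follows `α x` if `x` is in `T`, and `x` itself otherwise. For a tail neither
is earlier than `x`, so `σ x` is later unless the border closes up at the root. -/
theorem σ_of_notMem_heads (hM : M.IsRootedMap) (hT : M.IsSpanningTree T) {x : H}
    (hx : x ∉ M.heads T) :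
    M.σ x = M.root ∨ (M.restrict T).time x < (M.restrict T).time (M.σ x) := by
  have hf := hT.2.2.2
  have key : ∀ y, (M.restrict T).time x ≤ (M.restrict T).time y →
      M.σ x = (M.restrict T).border ((M.restrict T).time y + 1) →
      M.σ x = M.root ∨ (M.restrict T).time x < (M.restrict T).time (M.σ x) := by
    intro y hy h
    have := (M.restrict T).time_lt hf y
    rcases Nat.lt_or_ge ((M.restrict T).time y + 1) (Nat.card H) with h1 | h1
    · right
      rw [h, (M.restrict T).time_border hf h1]
      omega
    · left
      rw [h, show (M.restrict T).time y + 1 = Nat.card H by omega, (M.restrict T).border_card hf]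
      rfl
  rw [M.notMem_heads_iff T hM hT] at hx
  rcases hx with ⟨hx, h⟩ | ⟨hx, -, -⟩
  · refine key (M.α x) h.le ?_
    rw [← M.σ_α_of_mem T hT (hT.2.1 x hx), M.α_invol]
  · exact key x le_rfl (M.σ_of_notMem T hT hx)

/-- As long as only tails are met around the vertex, the time increases; hence a head is reached, at
the latest the root. -/
theorem exists_head (hM : M.IsRootedMap) (hT : M.IsSpanningTree T) (x : H) :
    ∃ k, (M.σ ^ k) x ∈ M.heads T := by
  have hf := hT.2.2.2
  induction hd : Nat.card H - (M.restrict T).time x using Nat.strong_induction_on generalizing x with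
  | _ d ih =>
    subst hd
    by_cases hx : x ∈ M.heads T
    · exact ⟨0, by simpa using hx⟩
    · rcases M.σ_of_notMem_heads T hM hT hx with h | h
      · exact ⟨1, by rw [pow_one, h]; exact .inl rfl⟩
      · have := (M.restrict T).time_lt hf (M.σ x)
        obtain ⟨k, hk⟩ := ih _ (by omega) (M.σ x) rfl
        exact ⟨k + 1, by rwa [pow_succ, Equiv.Perm.mul_apply]⟩

/-- Every half-edge other than the root is joined to a later one or to the root. A tail keeps its
successor in the explosion; a head `x` is joined to its tail `α x` and from there to `σ (α x)`. -/
theorem phi0_connected (hM : M.IsRootedMap) (hT : M.IsSpanningTree T) :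
    (M.phi0 (M.heads T)).Connected := by
  have hf := hT.2.2.2
  have htail : ∀ x, x ∉ M.heads T → (M.phi0 (M.heads T)).Reach x (M.σ x) := fun x hx =>
    .rel _ _ (.inl (M.phi0_σ_of_notMem _ (M.exists_head T hM hT x) hx).symm)
  have hall : ∀ x, (M.phi0 (M.heads T)).Reach x M.root := by
    intro x
    induction hd : Nat.card H - (M.restrict T).time x using Nat.strong_induction_on
      generalizing x with
    | _ d ih =>
      subst hd
      by_cases hx : x ∈ M.heads T
      · by_cases hr : x = M.root
        · rw [hr]; exact .refl _
        · have hα := M.α_notMem_heads T hM hT hx hr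
          have h1 : (M.phi0 (M.heads T)).Reach x (M.σ (M.α x)) :=
            .trans _ _ _ (.rel _ _ (.inr rfl)) (htail _ hα)
          refine .trans _ _ _ h1 ?_
          have key : M.σ (M.α x) = M.root ∨
              (M.restrict T).time x < (M.restrict T).time (M.σ (M.α x)) := by
            rw [M.mem_heads_iff T hM hT] at hx
            rcases hx with hx | ⟨hx, h⟩ | ⟨hx, h⟩
            · exact absurd hx hr
            · have h2 := (M.restrict T).time_lt hf x
              rw [M.σ_α_of_mem T hT hx]
              rcases Nat.lt_or_ge ((M.restrict T).time x + 1) (Nat.card H) with h1 | h1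
              · right
                rw [(M.restrict T).time_border hf h1]
                omega
              · left
                rw [show (M.restrict T).time x + 1 = Nat.card H by omega,
                  (M.restrict T).border_card hf]
                rfl
            · exact (M.σ_of_notMem_heads T hM hT hα).imp_right h.trans
          rcases key with h | h
          · rw [h]; exact .refl _
          · have := (M.restrict T).time_lt hf (M.σ (M.α x))
            exact ih _ (by omega) _ rfl
      · refine .trans _ _ _ (htail x hx) ?_
        rcases M.σ_of_notMem_heads T hM hT hx with h | h
        · rw [h]; exact .refl _
        · have := (M.restrict T).time_lt hf (M.σ x)
          exact ih _ (by omega) _ rfl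
  exact fun x y => .trans _ _ _ (hall x) (.symm _ _ (hall y))

/-- Each edge has one head and one tail, and the root is an additional head. -/
theorem ncard_heads (hM : M.IsRootedMap) (hT : M.IsSpanningTree T) :
    (M.heads T).ncard = M.size + 1 := by
  have h1 : M.α '' (M.heads T)ᶜ = M.heads T \ {M.root} := by
    ext x
    simp only [Set.mem_image, Set.mem_compl_iff, Set.mem_sdiff, Set.mem_singleton_iff]
    constructor
    · rintro ⟨y, hy, rfl⟩
      refine ⟨M.α_mem_heads T hM hT hy, fun h => hy ?_⟩
      rw [← M.α_invol y, h, M.α_root]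
      exact .inl rfl
    · rintro ⟨hx, hr⟩
      exact ⟨M.α x, M.α_notMem_heads T hM hT hx hr, M.α_invol x⟩
  have h2 := Set.ncard_sdiff_singleton_add_one (s := M.heads T) (a := M.root) (.inl rfl)
  rw [← h1, Set.ncard_image_of_injective _ M.α_invol.injective] at h2
  have h3 := Set.ncard_add_ncard_compl (M.heads T)
  rw [M.card_eq T hM hT] at h3
  omega

/-- The first moment at which the tour of `T` is at the vertex of `x`. -/
noncomputable def vertexTime (x : H) : ℕ :=
  sInf {k : ℕ | M.σ.SameCycle x ((M.restrict T).border k)}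

omit [Finite H] in
theorem vertexTime_le {x : H} {k : ℕ} (h : M.σ.SameCycle x ((M.restrict T).border k)) :
    M.vertexTime T x ≤ k := Nat.sInf_le h

theorem sameCycle_border_vertexTime (hT : M.IsSpanningTree T) (x : H) :
    M.σ.SameCycle x ((M.restrict T).border (M.vertexTime T x)) :=
  Nat.sInf_mem (s := {k : ℕ | M.σ.SameCycle x ((M.restrict T).border k)})
    ⟨(M.restrict T).time x, by
      change M.σ.SameCycle x _
      rw [(M.restrict T).border_time hT.2.2.2]⟩

/-- Using moments of the tour as labels for the vertices of `M` turns the freshness of a vertex into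
a comparison of numbers. -/
theorem vertexTime_eq_iff (hT : M.IsSpanningTree T) (x y : H) :
    M.vertexTime T x = M.vertexTime T y ↔ M.σ.SameCycle x y := by
  constructor
  · intro h
    have := M.sameCycle_border_vertexTime T hT x
    rw [h] at this
    exact this.trans (M.sameCycle_border_vertexTime T hT y).symm
  · intro h
    refine le_antisymm ?_ ?_
    · exact M.vertexTime_le T (h.trans (M.sameCycle_border_vertexTime T hT y))
    · exact M.vertexTime_le T (h.symm.trans (M.sameCycle_border_vertexTime T hT x))

end Tour

end HalfEdgeMap

/-! ### Operations on tree-sequences -/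

namespace SeqLetter

theorem expandFirstV_append {p s : List SeqLetter} (hp : v ∉ p) :
    expandFirstV (p ++ v :: s) = p ++ u :: tree PlaneTree.tau :: v :: s := by
  induction p with
  | nil => rfl
  | cons x p ih =>
    rw [List.mem_cons, not_or] at hp
    rw [List.cons_append, List.cons_append, ← ih hp.2]
    cases x with
    | v => exact absurd rfl hp.1
    | _ => rfl

theorem expandFirstU_append {p s : List SeqLetter} (hp : u ∉ p) :
    expandFirstU (p ++ u :: s) = p ++ v :: tree PlaneTree.tau :: u :: s := by
  induction p with
  | nil => rfl
  | cons x p ih =>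
    rw [List.mem_cons, not_or] at hp
    rw [List.cons_append, List.cons_append, ← ih hp.2]
    cases x with
    | u => exact absurd rfl hp.1
    | _ => rfl

theorem expandLastU_append {p s : List SeqLetter} (hs : u ∉ s) :
    expandLastU (p ++ u :: s) = p ++ u :: tree PlaneTree.tau :: v :: s := by
  have h : (p ++ u :: s).reverse = s.reverse ++ u :: p.reverse := by simp
  rw [expandLastU, h, expandFirstU_append (by simpa using hs)]
  simp

theorem mergeFirstV_append {p s : List SeqLetter} {t₁ t₂ : PlaneTree} (hp : v ∉ p) :
    mergeFirstV (p ++ tree t₁ :: v :: tree t₂ :: s) = p ++ tree (PlaneTree.sigma t₁ t₂) :: s := by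
  induction p with
  | nil => rfl
  | cons x p ih =>
    rw [List.mem_cons, not_or] at hp
    rw [List.cons_append, List.cons_append, ← ih hp.2]
    cases p with
    | nil => cases x <;> rfl
    | cons y p =>
      cases x <;> cases y <;> first | rfl | simp at hp

theorem mergeFirstU_append {p s : List SeqLetter} {t₁ t₂ : PlaneTree} (hp : u ∉ p) :
    mergeFirstU (p ++ tree t₂ :: u :: tree t₁ :: s) = p ++ tree (PlaneTree.sigma t₁ t₂) :: s := by
  induction p with
  | nil => rfl
  | cons x p ih =>
    rw [List.mem_cons, not_or] at hp
    rw [List.cons_append, List.cons_append, ← ih hp.2]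
    cases p with
    | nil => cases x <;> rfl
    | cons y p =>
      cases x <;> cases y <;> first | rfl | simp at hp

theorem mergeLastU_append {p s : List SeqLetter} {t₁ t₂ : PlaneTree} (hs : u ∉ s) :
    mergeLastU (p ++ tree t₁ :: u :: tree t₂ :: s) = p ++ tree (PlaneTree.sigma t₁ t₂) :: s := by
  have h : (p ++ tree t₁ :: u :: tree t₂ :: s).reverse =
      s.reverse ++ tree t₂ :: u :: tree t₁ :: p.reverse := by simp
  rw [mergeLastU, h, mergeFirstU_append (by simpa using hs)]
  simp

end SeqLetter

/-! ### Binary trees with active leaves -/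

/-- What one meets when a binary tree is read from right to left: the active left leaves, the active
right leaves (with the chain label of the father) and the nodes. -/
inductive Visit (N V : Type*)
  | left
  | right (v : V)
  | node (x : N)

namespace Visit

variable {N V : Type*}

def node? : Visit N V → Option N
  | node x => some x
  | _ => none

/-- The nodes met. -/
def nodes (s : List (Visit N V)) : List N := s.filterMap node?

theorem nodes_append (s t : List (Visit N V)) : nodes (s ++ t) = nodes s ++ nodes t :=
  List.filterMap_append

theorem nodes_map_node (l : List N) : nodes (l.map (node (V := V))) = l := by
  induction l with
  | nil => rfl
  | cons x l ih =>
    have : nodes ((x :: l).map (node (V := V))) = x :: nodes (l.map (node (V := V))) := rfl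
    rw [this, ih]

end Visit

/-- The binary tree `B` with active leaves is read as `s` from right to left, in such a way that a
right son has the same chain label `c` as its father. The list `ts` contains the chain labels of the
top nodes of the chains. -/
inductive Reading {N V : Type*} (c : N → V) :
    Option V → BinTree Bool → List (Visit N V) → List V → Prop
  | inactive (o : Option V) : Reading c o (.leaf false) [] []
  | activeLeft : Reading c none (.leaf true) [.left] []
  | activeRight (v : V) : Reading c (some v) (.leaf true) [.right v] []
  | node {o : Option V} {x : N} {l r : BinTree Bool} {s t : List (Visit N V)} {ss ts : List V}
      (ho : ∀ v ∈ o, v = c x) : Reading c (some (c x)) r s ss → Reading c none l t ts →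
      Reading c o (.node l r) (s ++ .node x :: t) (o.elim [c x] (fun _ => []) ++ (ss ++ ts))

namespace Reading

variable {N V : Type*} {c : N → V}

theorem replaceFirstRight_eq_none {o : Option V} {B : BinTree Bool} {s : List (Visit N V)}
    {ts : List V} (h : Reading c o B s ts) (new : BinTree Bool) (hs : ∀ v, .right v ∉ s) :
    BinTree.replaceFirstRight new o.isSome B = none := by
  induction h with
  | inactive | activeLeft => simp [BinTree.replaceFirstRight]
  | activeRight v => simp at hs
  | node _ _ _ ih1 ih2 =>
    have h1 := ih1 fun v hv => hs v (by simp [hv])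
    have h2 := ih2 fun v hv => hs v (by simp [hv])
    simp only [Option.isSome_some, Option.isSome_none] at h1 h2
    simp [BinTree.replaceFirstRight, h1, h2]

theorem replaceLastLeft_eq_none {o : Option V} {B : BinTree Bool} {s : List (Visit N V)}
    {ts : List V} (h : Reading c o B s ts) (new : BinTree Bool) (hs : .left ∉ s) :
    BinTree.replaceLastLeft new o.isNone B = none := by
  induction h with
  | inactive | activeRight => simp [BinTree.replaceLastLeft]
  | activeLeft => simp at hs
  | node _ _ _ ih1 ih2 =>
    have h1 := ih1 fun hv => hs (by simp [hv])
    have h2 := ih2 fun hv => hs (by simp [hv])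
    simp only [Option.isNone_some, Option.isNone_none] at h1 h2
    simp [BinTree.replaceLastLeft, h1, h2]

/-- As the reading goes from right to left, the first active right leaf is the last `.right` entry.
If this entry belongs to the left subtree, it is found there; if not, the search on the left fails
and passes to the right subtree. Chain tops matter only up to order. -/
theorem replaceFirstRight {o : Option V} {B : BinTree Bool} {s : List (Visit N V)}
    {ts : List V} (h : Reading c o B s ts) {new : BinTree Bool} {p q s' : List (Visit N V)}
    {ts' : List V} {v : V} (hs : s = p ++ .right v :: q) (hq : ∀ w, .right w ∉ q)
    (hnew : Reading c (some v) new s' ts') :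
    ∃ B' ts'', BinTree.replaceFirstRight new o.isSome B = some B' ∧
      Reading c o B' (p ++ s' ++ q) ts'' ∧ ts''.Perm (ts' ++ ts) := by
  induction h generalizing p q with
  | inactive o => simp at hs
  | activeLeft =>
    rcases p with _ | ⟨x, p⟩ <;> simp at hs
  | activeRight w =>
    rcases p with _ | ⟨x, p⟩
    · simp at hs
      obtain ⟨rfl, rfl⟩ := hs
      exact ⟨new, ts', by simp [BinTree.replaceFirstRight], by simpa using hnew, by simp⟩
    · simp at hs
  | @node o x l r s t ss ts ho hr hl ih1 ih2 =>
    rcases List.append_eq_append_iff.mp hs with ⟨d, hp, hd⟩ | ⟨d, hp, hd⟩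
    · rcases d with _ | ⟨y, d⟩
      · simp at hd
      · simp only [List.cons_append, List.cons.injEq] at hd
        obtain ⟨rfl, rfl⟩ := hd
        obtain ⟨l', ts'', h1, h2, h3⟩ := ih2 rfl hq
        simp only [Option.isSome_none] at h1
        refine ⟨.node l' r, o.elim [c x] (fun _ => []) ++ (ss ++ ts''), by simp [BinTree.replaceFirstRight, h1], ?_, ?_⟩
        · have := Reading.node ho hr h2
          rw [hp]
          simpa using this
        · rw [← Multiset.coe_eq_coe] at h3 ⊢
          simp only [← Multiset.coe_add] at h3 ⊢
          rw [h3]; abel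
    · rcases d with _ | ⟨y, d⟩
      · simp at hd
      · simp only [List.cons_append, List.cons.injEq] at hd
        obtain ⟨rfl, rfl⟩ := hd
        obtain ⟨r', ts'', h1, h2, h3⟩ := ih1 hp fun w hw => hq w (by simp [hw])
        have h4 := hl.replaceFirstRight_eq_none new fun w hw => hq w (by simp [hw])
        simp only [Option.isSome_none, Option.isSome_some] at h1 h4
        refine ⟨.node l r', o.elim [c x] (fun _ => []) ++ (ts'' ++ ts), by simp [BinTree.replaceFirstRight, h1, h4], ?_, ?_⟩
        · have := Reading.node ho h2 hl
          simpa using this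
        · rw [← Multiset.coe_eq_coe] at h3 ⊢
          simp only [← Multiset.coe_add] at h3 ⊢
          rw [h3]; abel

theorem replaceLastLeft {o : Option V} {B : BinTree Bool} {s : List (Visit N V)}
    {ts : List V} (h : Reading c o B s ts) {new : BinTree Bool} {p q s' : List (Visit N V)}
    {ts' : List V} (hs : s = p ++ .left :: q) (hp : .left ∉ p)
    (hnew : Reading c none new s' ts') :
    ∃ B' ts'', BinTree.replaceLastLeft new o.isNone B = some B' ∧
      Reading c o B' (p ++ s' ++ q) ts'' ∧ ts''.Perm (ts' ++ ts) := by
  induction h generalizing p q with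
  | inactive o => simp at hs
  | activeRight =>
    rcases p with _ | ⟨x, p⟩ <;> simp at hs
  | activeLeft =>
    rcases p with _ | ⟨x, p⟩
    · simp at hs
      obtain rfl := hs
      exact ⟨new, ts', by simp [BinTree.replaceLastLeft], by simpa using hnew, by simp⟩
    · simp at hs
  | @node o x l r s t ss ts ho hr hl ih1 ih2 =>
    rcases List.append_eq_append_iff.mp hs with ⟨d, hd', hd⟩ | ⟨d, hd', hd⟩
    · rcases d with _ | ⟨y, d⟩
      · simp at hd
      · simp only [List.cons_append, List.cons.injEq] at hd
        obtain ⟨rfl, rfl⟩ := hd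
        obtain ⟨l', ts'', h1, h2, h3⟩ := ih2 rfl fun h => hp (by simp [hd', h])
        have h4 := hr.replaceLastLeft_eq_none new fun h => hp (by simp [hd', h])
        simp only [Option.isNone_none, Option.isNone_some] at h1 h4
        refine ⟨.node l' r, o.elim [c x] (fun _ => []) ++ (ss ++ ts''), by simp [BinTree.replaceLastLeft, h1, h4], ?_, ?_⟩
        · have := Reading.node ho hr h2
          rw [hd']
          simpa using this
        · rw [← Multiset.coe_eq_coe] at h3 ⊢
          simp only [← Multiset.coe_add] at h3 ⊢
          rw [h3]; abel
    · rcases d with _ | ⟨y, d⟩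
      · simp at hd
      · simp only [List.cons_append, List.cons.injEq] at hd
        obtain ⟨rfl, rfl⟩ := hd
        obtain ⟨r', ts'', h1, h2, h3⟩ := ih1 hd' hp
        simp only [Option.isNone_some] at h1
        refine ⟨.node l r', o.elim [c x] (fun _ => []) ++ (ts'' ++ ts), by simp [BinTree.replaceLastLeft, h1], ?_, ?_⟩
        · have := Reading.node ho h2 hl
          simpa using this
        · rw [← Multiset.coe_eq_coe] at h3 ⊢
          simp only [← Multiset.coe_add] at h3 ⊢
          rw [h3]; abel

/-- A binary tree in which the tops of the chains have different labels. -/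
theorem chainLabels {o : Option V} {B : BinTree Bool} {s : List (Visit N V)} {ts : List V}
    (h : Reading c o B s ts) (hts : (o.toList ++ ts).Nodup) :
    ChainLabels o B.forget ((Visit.nodes s).map c) ∧
      ∀ x ∈ (Visit.nodes s).map c, x ∈ o.toList ++ ts := by
  induction h with
  | inactive o => exact ⟨.leaf _ _, by simp [Visit.nodes]⟩
  | activeLeft => exact ⟨.leaf _ _, by simp [Visit.nodes, Visit.node?]⟩
  | activeRight v => exact ⟨.leaf _ _, by simp [Visit.nodes, Visit.node?]⟩
  | @node o x l r s t ss ts ho hr hl ih1 ih2 =>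
    have hnodes : (Visit.nodes (s ++ .node x :: t)).map c =
        (Visit.nodes s).map c ++ c x :: (Visit.nodes t).map c := by
      rw [Visit.nodes_append, List.map_append]; rfl
    -- The label `c x` is either the father's label in `o` or a new chain top; in both cases it is
    -- listed exactly once.
    have hts' : (c x :: (ss ++ ts)).Nodup ∧
        ∀ y, y ∈ c x :: (ss ++ ts) → y ∈ o.toList ++ (o.elim [c x] (fun _ => []) ++ (ss ++ ts)) := by
      cases o with
      | none => simpa using hts
      | some v =>
        obtain rfl := ho v rfl
        simpa using hts
    obtain ⟨h1, h2⟩ := hts'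
    have hx : c x ∉ ts := fun h => (List.nodup_cons.mp h1).1 (by simp [h])
    have hss : ((some (c x)).toList ++ ss).Nodup := by
      refine h1.sublist ?_
      simp
    have htt : ts.Nodup := h1.sublist (by simp)
    have hd := (List.nodup_append'.mp (List.nodup_cons.mp h1).2).2.2
    obtain ⟨hr1, hr2⟩ := ih1 hss
    obtain ⟨hl1, hl2⟩ := ih2 (by simpa using htt)
    simp only [Option.toList_none, Option.toList_some, List.nil_append, List.singleton_append] at hr2 hl2
    rw [hnodes]
    refine ⟨.node ho hr1 hl1 (fun h => hx (hl2 _ h)) ?_, ?_⟩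
    · intro y hy hy'
      rcases List.mem_cons.mp (hr2 y hy) with rfl | h
      · exact hx (hl2 _ hy')
      · exact hd h (hl2 y hy')
    · intro y hy
      apply h2
      simp only [List.mem_append, List.mem_cons] at hy ⊢
      rcases hy with hy | rfl | hy
      · have := List.mem_cons.mp (hr2 y hy); tauto
      · simp
      · have := hl2 y hy; tauto

end Reading

/-! ### The two stacks of a prefix-shuffle -/

/-- A vertex of the vertex explosion during the tour: the half-edge reached at this vertex, the
subtrees that are already known, and the heads of their vertices in prefix order. -/
abbrev StackEntry (H : Type*) := H × List PlaneTree × List H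

namespace StackEntry

variable {H : Type*}

/-- The tree-sequence with the trees of `L` (from top to bottom) to the left of the current tree, and
those of `R` to the right. -/
def encode (C : StackEntry H) (L R : List (StackEntry H)) : List SeqLetter :=
  L.reverse.flatMap (fun p => [.u, .tree (.node p.2.1)]) ++
    .u :: .tree (.node C.2.1) :: .v :: R.flatMap (fun p => [.tree (.node p.2.1), .v])

/-- The last `u` and the first `v` of `encode C L R` are the two neighbours of the tree of `C`, so
every step of `λ₀` acts next to it. The half-edge `x` is arbitrary because `encode` does not record
half-edges. -/
theorem lambda0Step_a (x : H) (C : StackEntry H) (L R : List (StackEntry H)) :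
    lambda0Step (encode C L R) .a = encode (x, [], []) L (C :: R) := by
  have := SeqLetter.expandLastU_append
    (p := L.reverse.flatMap (fun p => [.u, .tree (.node p.2.1)]))
    (s := .tree (.node C.2.1) :: .v :: R.flatMap (fun p => [.tree (.node p.2.1), .v]))
    (by simp)
  simpa [lambda0Step, encode, PlaneTree.tau] using this

theorem lambda0Step_b (x : H) (C : StackEntry H) (L R : List (StackEntry H)) :
    lambda0Step (encode C L R) .b = encode (x, [], []) (C :: L) R := by
  have := SeqLetter.expandFirstV_append
    (p := L.reverse.flatMap (fun p => [.u, .tree (.node p.2.1)]) ++ [.u, .tree (.node C.2.1)])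
    (s := R.flatMap (fun p => [.tree (.node p.2.1), .v]))
    (by simp)
  simpa [lambda0Step, encode, PlaneTree.tau] using this

theorem lambda0Step_abar (x : H) (ls : List H) (C p : StackEntry H) (L R : List (StackEntry H)) :
    lambda0Step (encode C L (p :: R)) .abar =
      encode (x, p.2.1 ++ [.node C.2.1], ls) L R := by
  have := SeqLetter.mergeFirstV_append
    (p := L.reverse.flatMap (fun p => [.u, .tree (.node p.2.1)]) ++ [.u])
    (s := .v :: R.flatMap (fun p => [.tree (.node p.2.1), .v])) (t₁ := .node C.2.1)
    (t₂ := .node p.2.1) (by simp)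
  simpa [lambda0Step, encode, PlaneTree.sigma] using this

theorem lambda0Step_bbar (x : H) (ls : List H) (C p : StackEntry H) (L R : List (StackEntry H)) :
    lambda0Step (encode C (p :: L) R) .bbar =
      encode (x, C.2.1 ++ [.node p.2.1], ls) L R := by
  have := SeqLetter.mergeLastU_append
    (p := L.reverse.flatMap (fun p => [.u, .tree (.node p.2.1)]) ++ [.u])
    (s := .v :: R.flatMap (fun p => [.tree (.node p.2.1), .v])) (t₁ := .node p.2.1)
    (t₂ := .node C.2.1) (by simp)
  simpa [lambda0Step, encode, PlaneTree.sigma] using this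

variable {V : Type*} (f : H → H) (c : H → V)

/-- The reading of the binary tree that corresponds to `encode C L R`; the node corresponding to a
vertex is labelled by its head. -/
def visits (C : StackEntry H) (L R : List (StackEntry H)) : List (Visit H V) :=
  R.reverse.flatMap (fun p => .right (c p.1) :: (f p.1 :: p.2.2).map .node) ++
    .right (c C.1) :: ((f C.1 :: C.2.2).map .node ++
      .left :: L.flatMap (fun p => (f p.1 :: p.2.2).map .node ++ [.left]))

theorem reading_binB1_none {N : Type*} (c : N → V) (x : N) :
    Reading c none binB1 [.right (c x), .node x, .left] [c x] :=
  .node (s := [.right (c x)]) (t := [.left]) (by simp) (.activeRight _) .activeLeft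

theorem reading_binB1_some {N : Type*} (c : N → V) (x : N) :
    Reading c (some (c x)) binB1 [.right (c x), .node x, .left] [] :=
  .node (s := [.right (c x)]) (t := [.left]) (by simp) (.activeRight _) .activeLeft

/-- In a reading, `none` stands for a left son as well as for the root, whereas `lambda1Step` starts
with the flag of the root. The flag only matters for a tree that is a single leaf. -/
theorem replaceLastLeft_flag {N : Type*} {c : N → V} {B : BinTree Bool} {s : List (Visit N V)}
    {ts : List V} (h : Reading c none B s ts) {x : N} (hx : .node x ∈ s) (new : BinTree Bool) :
    BinTree.replaceLastLeft new false B = BinTree.replaceLastLeft new true B := by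
  cases h with
  | inactive => simp at hx
  | activeLeft => simp at hx
  | node => rfl

variable {f c}

theorem node_mem_visits (C : StackEntry H) (L R : List (StackEntry H)) :
    .node (f C.1) ∈ visits f c C L R := by simp [visits]

/-- The leaf replaced is a left one, so the new node is the top of a new chain and contributes the
label `c x`. -/
theorem reading_a {B : BinTree Bool} {C : StackEntry H} {L R : List (StackEntry H)} {ts : List V}
    (h : Reading c none B (visits f c C L R) ts) {x : H} (hx : c (f x) = c x) :
    ∃ ts', Reading c none (lambda1Step B .a) (visits f c (x, [], []) L (C :: R)) ts' ∧
      ts'.Perm (c x :: ts) := by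
  obtain ⟨B', ts', h1, h2, h3⟩ := h.replaceLastLeft
    (p := R.reverse.flatMap (fun p => .right (c p.1) :: (f p.1 :: p.2.2).map .node) ++
      .right (c C.1) :: ((f C.1 :: C.2.2).map .node))
    (q := L.flatMap (fun p => (f p.1 :: p.2.2).map .node ++ [.left]))
    (by simp [visits]) (by simp) (reading_binB1_none c (f x))
  refine ⟨ts', ?_, by simpa [hx] using h3⟩
  have h4 : lambda1Step B .a = B' := by
    rw [lambda1Step, replaceLastLeft_flag h (node_mem_visits C L R)]
    simp only [Option.isNone_none] at h1
    rw [h1]; rfl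
  rw [h4]
  simpa [visits, hx] using h2

/-- The leaf replaced is a right one, at the end of the chain labelled `c C.1`. The new node
prolongs this chain, which is why the two labels have to agree. -/
theorem reading_b {B : BinTree Bool} {C : StackEntry H} {L R : List (StackEntry H)} {ts : List V}
    (h : Reading c none B (visits f c C L R) ts) {x : H} (hx : c (f x) = c x) (hC : c C.1 = c x) :
    ∃ ts', Reading c none (lambda1Step B .b) (visits f c (x, [], []) (C :: L) R) ts' ∧
      ts'.Perm ts := by
  obtain ⟨B', ts', h1, h2, h3⟩ := h.replaceFirstRight
    (p := R.reverse.flatMap (fun p => .right (c p.1) :: (f p.1 :: p.2.2).map .node))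
    (q := (f C.1 :: C.2.2).map .node ++
      .left :: L.flatMap (fun p => (f p.1 :: p.2.2).map .node ++ [.left]))
    (v := c (f x)) (by simp [visits, hx, hC]) (by simp) (reading_binB1_some c (f x))
  refine ⟨ts', ?_, by simpa using h3⟩
  have h4 : lambda1Step B .b = B' := by
    simp only [Option.isSome_none] at h1
    rw [lambda1Step, h1]; rfl
  rw [h4]
  simpa [visits, hx] using h2

/-- Once the right leaf of `C` is inactive, nothing separates the nodes of `p` from those of `C`.
They become the prefix order of the tree in which `C` is the last son of `p`. -/
theorem reading_abar {B : BinTree Bool} {C p : StackEntry H} {L R : List (StackEntry H)}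
    {ts : List V} (h : Reading c none B (visits f c C L (p :: R)) ts) {x : H}
    (hx : c p.1 = c x) (hf : f p.1 = f x) (t : List PlaneTree) :
    ∃ ts', Reading c none (lambda1Step B .abar)
      (visits f c (x, t, p.2.2 ++ f C.1 :: C.2.2) L R) ts' ∧ ts'.Perm ts := by
  obtain ⟨B', ts', h1, h2, h3⟩ := h.replaceFirstRight
    (p := (p :: R).reverse.flatMap (fun p => .right (c p.1) :: (f p.1 :: p.2.2).map .node))
    (q := (f C.1 :: C.2.2).map .node ++
      .left :: L.flatMap (fun p => (f p.1 :: p.2.2).map .node ++ [.left]))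
    (v := c C.1) (by simp [visits]) (by simp) (.inactive _)
  refine ⟨ts', ?_, by simpa using h3⟩
  have h4 : lambda1Step B .abar = B' := by
    simp only [Option.isSome_none] at h1
    rw [lambda1Step, h1]; rfl
  rw [h4]
  simpa [visits, ← hx, ← hf] using h2

theorem reading_bbar {B : BinTree Bool} {C p : StackEntry H} {L R : List (StackEntry H)}
    {ts : List V} (h : Reading c none B (visits f c C (p :: L) R) ts) {x : H}
    (hx : c C.1 = c x) (hf : f C.1 = f x) (t : List PlaneTree) :
    ∃ ts', Reading c none (lambda1Step B .bbar)
      (visits f c (x, t, C.2.2 ++ f p.1 :: p.2.2) L R) ts' ∧ ts'.Perm ts := by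
  obtain ⟨B', ts', h1, h2, h3⟩ := h.replaceLastLeft
    (p := R.reverse.flatMap (fun p => .right (c p.1) :: (f p.1 :: p.2.2).map .node) ++
      .right (c C.1) :: ((f C.1 :: C.2.2).map .node))
    (q := (p :: L).flatMap (fun p => (f p.1 :: p.2.2).map .node ++ [.left]))
    (by simp [visits]) (by simp) (.inactive _)
  refine ⟨ts', ?_, by simpa using h3⟩
  have h4 : lambda1Step B .bbar = B' := by
    rw [lambda1Step, replaceLastLeft_flag h (node_mem_visits C _ R)]
    simp only [Option.isNone_none] at h1
    rw [h1]; rfl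
  rw [h4]
  simpa [visits, ← hx, ← hf] using h2

end StackEntry

/-! ### The tour of the spanning tree as a run of the two stacks -/

namespace HalfEdgeMap

variable {H : Type*} (M : HalfEdgeMap H) (T : Set H)

/-- The half-edges of `S` met up to the moment `k` whose other half is met later, the last one
first. -/
def IsOpenList (S : Set H) (k : ℕ) (l : List H) : Prop :=
  l.Pairwise (fun x y => (M.restrict T).time y < (M.restrict T).time x) ∧
    ∀ x, x ∈ l ↔ x ∈ S ∧ (M.restrict T).time x ≤ k ∧ k < (M.restrict T).time (M.α x)

open Classical in
/-- The letter written during the step `k + 1`. -/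
noncomputable def tourLetter (k : ℕ) : Letter :=
  let h := (M.restrict T).border (k + 1)
  if h ∈ T then (if M.Precedes T h (M.α h) then Letter.a else Letter.abar)
  else (if M.Precedes T h (M.α h) then Letter.b else Letter.bbar)

theorem shuffle_eq : M.shuffle T = (List.range (2 * M.size)).map (M.tourLetter T) := rfl

variable {M T}

theorem IsOpenList.nodup {S : Set H} {k : ℕ} {l : List H} (h : M.IsOpenList T S k l) : l.Nodup :=
  h.1.imp fun h e => by rw [e] at h; exact lt_irrefl _ h

variable [Finite H]

theorem IsOpenList.push {S : Set H} {k : ℕ} {l : List H} (h : M.IsOpenList T S k l)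
    (hT : M.IsSpanningTree T) {x : H} (hx : x ∈ S) (hxk : (M.restrict T).time x = k + 1)
    (hα : k + 1 < (M.restrict T).time (M.α x)) : M.IsOpenList T S (k + 1) (x :: l) := by
  refine ⟨List.pairwise_cons.mpr ⟨fun y hy => ?_, h.1⟩, fun y => ?_⟩
  · have := ((h.2 y).mp hy).2.1
    omega
  · rw [List.mem_cons, h.2]
    constructor
    · rintro (rfl | ⟨h1, h2, h3⟩)
      · exact ⟨hx, hxk.le, hα⟩
      · refine ⟨h1, by omega, ?_⟩
        have : (M.restrict T).time (M.α y) ≠ k + 1 := fun h4 => by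
          have h5 := (M.restrict T).time_inj hT.2.2.2 (h4.trans hxk.symm)
          rw [← h5, M.α_invol] at hα
          omega
        omega
    · rintro ⟨h1, h2, h3⟩
      by_cases hy : y = x
      · exact .inl hy
      · have : (M.restrict T).time y ≠ k + 1 := fun h4 =>
          hy ((M.restrict T).time_inj hT.2.2.2 (h4.trans hxk.symm))
        exact .inr ⟨h1, by omega, by omega⟩

theorem IsOpenList.skip {S : Set H} {k : ℕ} {l : List H} (h : M.IsOpenList T S k l)
    (hT : M.IsSpanningTree T) (hS : ∀ y ∈ S, M.α y ∈ S) {x : H} (hx : x ∉ S)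
    (hxk : (M.restrict T).time x = k + 1) : M.IsOpenList T S (k + 1) l := by
  refine ⟨h.1, fun y => ?_⟩
  rw [h.2]
  refine and_congr_right fun hy => ?_
  have h1 : (M.restrict T).time y ≠ k + 1 := fun h4 =>
    hx ((M.restrict T).time_inj hT.2.2.2 (h4.trans hxk.symm) ▸ hy)
  have h2 : (M.restrict T).time (M.α y) ≠ k + 1 := fun h4 =>
    hx ((M.restrict T).time_inj hT.2.2.2 (h4.trans hxk.symm) ▸ hS y hy)
  omega

/-- The half-edge `x` closes the edge opened at `α x`. An entry above `α x` would be an edge opened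
later and still open after `x`, hence crossing the edge of `x`. The hypothesis `hST` makes the two
edges of the same kind. -/
theorem IsOpenList.pop {S : Set H} {k : ℕ} {l : List H} (h : M.IsOpenList T S k l)
    (hM : M.IsRootedMap) (hT : M.IsSpanningTree T) (hS : ∀ y ∈ S, M.α y ∈ S)
    (hST : ∀ y ∈ S, ∀ z ∈ S, (y ∈ T ↔ z ∈ T)) {x : H} (hx : x ∈ S)
    (hxk : (M.restrict T).time x = k + 1) (hα : (M.restrict T).time (M.α x) < k + 1) :
    ∃ l', l = M.α x :: l' ∧ M.IsOpenList T S (k + 1) l' := by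
  have hmem : M.α x ∈ l := (h.2 _).mpr ⟨hS x hx, by omega, by rw [M.α_invol]; omega⟩
  rcases l with _ | ⟨p, l⟩
  · simp at hmem
  · obtain rfl : p = M.α x := by
      rcases List.mem_cons.mp hmem with h1 | h1
      · exact h1.symm
      · exfalso
        have h2 := List.rel_of_pairwise_cons h.1 h1
        have hp := (h.2 p).mp (by simp)
        have hne : (M.restrict T).time (M.α p) ≠ k + 1 := fun h4 => by
          have h5 := (M.restrict T).time_inj hT.2.2.2 (h4.trans hxk.symm)
          rw [← h5, M.α_invol] at h2
          exact lt_irrefl _ h2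
        refine M.not_crossing_of_spanningTree T hM hT (x := M.α x) (y := p)
          (hST _ (hS x hx) _ hp.1) h2 ?_ ?_
        · rw [M.α_invol]; omega
        · rw [M.α_invol]; omega
    refine ⟨l, rfl, (List.pairwise_cons.mp h.1).2, fun y => ?_⟩
    have hnot := (List.nodup_cons.mp h.nodup).1
    constructor
    · intro hy
      have h1 := (h.2 y).mp (by simp [hy])
      have : (M.restrict T).time (M.α y) ≠ k + 1 := fun h4 => by
        have h5 := (M.restrict T).time_inj hT.2.2.2 (h4.trans hxk.symm)
        rw [← h5, M.α_invol] at hnot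
        exact hnot hy
      exact ⟨h1.1, by omega, by omega⟩
    · rintro ⟨h1, h2, h3⟩
      have h4 : (M.restrict T).time y ≠ k + 1 := fun h4 => by
        rw [(M.restrict T).time_inj hT.2.2.2 (h4.trans hxk.symm)] at h3
        omega
      have h5 := (h.2 y).mpr ⟨h1, by omega, by omega⟩
      rcases List.mem_cons.mp h5 with rfl | h5
      · rw [M.α_invol] at h3
        omega
      · exact h5

variable (M T)

/-- The state of the two stacks after `k` steps of the tour of `T`, during which the word `w` has been
written. -/
structure IsTourState (k : ℕ) (w : List Letter) (C : StackEntry H) (L R : List (StackEntry H))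
    (ts : List ℕ) : Prop where
  current : C.1 = (M.restrict T).border (k + 1)
  left : M.IsOpenList T Tᶜ k (L.map Prod.fst)
  right : M.IsOpenList T T k (R.map Prod.fst)
  -- For an entry of `L`, `p.1` is a head and thus its own first head, so the vertex is complete.
  -- For an entry of `R`, `p.1` is a tail and the vertex still awaits this son.
  sons : ∀ p ∈ C :: (L ++ R),
    (M.phi0 (M.heads T)).Sons (M.firstHead (M.heads T) p.1) p.2.1 p.1 p.2.2
  sequence : lambda0 w = StackEntry.encode C L R
  reading : Reading (M.vertexTime T) none (lambda1 w)
    (StackEntry.visits (M.firstHead (M.heads T)) (M.vertexTime T) C L R) ts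
  nodup : ts.Nodup
  le : ∀ v ∈ ts, v ≤ k + 1
  heads : ∀ x ∈ M.heads T, x ≠ M.root → (M.restrict T).time x ≤ k →
    ∃ p ∈ C :: (L ++ R), x ∈ M.firstHead (M.heads T) p.1 :: p.2.2
  -- The letters `a` and `b` add a vertex and an open edge, while `ā` and `b̄` close an edge and
  -- keep the vertices. With no open edges left after `2n` steps, there are `n + 1` vertices.
  length : 2 * ((C :: (L ++ R)).flatMap
    (fun p => M.firstHead (M.heads T) p.1 :: p.2.2)).length = k + L.length + R.length + 2

variable {M T}

theorem vertexTime_firstHead (hT : M.IsSpanningTree T) (O : Set H) (x : H) :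
    M.vertexTime T (M.firstHead O x) = M.vertexTime T x :=
  (M.vertexTime_eq_iff T hT _ _).mpr (M.sameCycle_firstHead O x).symm

theorem exists_tourState_zero (hM : M.IsRootedMap) (hT : M.IsSpanningTree T) :
    ∃ C L R ts, M.IsTourState T 0 [] C L R ts := by
  have hf := hT.2.2.2
  have h1 : (M.restrict T).border 1 = M.σ M.root := by
    rw [M.σ_of_notMem T hT hT.1, show (M.restrict T).time M.root = 0 from (M.restrict T).time_root]
  have hopen (S : Set H) : M.IsOpenList T S 0 [] := by
    refine ⟨.nil, fun x => ?_⟩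
    simp only [List.not_mem_nil, false_iff, not_and]
    intro _ h
    have : x = M.root := (M.restrict T).time_inj hf
      ((Nat.le_zero.mp h).trans (M.restrict T).time_root.symm)
    rw [this, M.α_root, show (M.restrict T).time M.root = 0 from (M.restrict T).time_root]
    simp
  have hs := Sons.nil (M := M.phi0 (M.heads T))
    (M.firstHead (M.heads T) ((M.restrict T).border 1))
  rw [h1, M.phi0_σ_firstHead _ (M.exists_head T hM hT) (y := M.root) (.inl rfl), ← h1] at hs
  refine ⟨((M.restrict T).border 1, [], []), [], [],
    [M.vertexTime T ((M.restrict T).border 1)], rfl, hopen _, hopen _, by simpa using hs, rfl, ?_,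
    by simp, ?_, ?_, by simp⟩
  · have := StackEntry.reading_binB1_none (M.vertexTime T)
      (M.firstHead (M.heads T) ((M.restrict T).border 1))
    rw [vertexTime_firstHead hT] at this
    simpa [lambda1, StackEntry.visits, vertexTime_firstHead hT] using this
  · simpa using M.vertexTime_le T (.refl _ _)
  · intro x _ hx h
    exact absurd ((M.restrict T).time_inj hf
      ((Nat.le_zero.mp h).trans (M.restrict T).time_root.symm)) hx

/-- The current half-edge `x` gives four cases. A tail in `T` (`a`) suspends its vertex on `R` and
enters a new vertex of `M`; the head of that edge (`ā`) completes the subtree and hangs it below the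
suspended vertex. A head outside `T` (`b`) completes an exploded vertex, whose subtree waits on `L`
while the tour begins another exploded vertex at the same vertex of `M`; the matching tail (`b̄`)
hangs the waiting subtree below the current vertex. -/
theorem IsTourState.step {k : ℕ} {w : List Letter} {C : StackEntry H} {L R : List (StackEntry H)}
    {ts : List ℕ} (h : M.IsTourState T k w C L R ts) (hM : M.IsRootedMap)
    (hT : M.IsSpanningTree T) (hk : k + 1 < Nat.card H) :
    ∃ C' L' R' ts', M.IsTourState T (k + 1) (w ++ [M.tourLetter T k]) C' L' R' ts' := by
  have hf := hT.2.2.2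
  set x := (M.restrict T).border (k + 1) with hx
  set y := (M.restrict T).border (k + 1 + 1) with hy
  have hxk : (M.restrict T).time x = k + 1 := (M.restrict T).time_border hf hk
  have hxr : x ≠ M.root := fun h => by
    have := (M.restrict T).time_root
    rw [h] at hxk
    change (M.restrict T).time M.root = 0 at this
    omega
  have hCx : C.1 = x := h.current
  have hαx : (M.restrict T).time (M.α x) ≠ k + 1 := fun h => by
    exact M.α_ne hM hxr ((M.restrict T).time_inj hf (h.trans hxk.symm))
  have hhd := M.exists_head T hM hT
  have h0 (l : Letter) : lambda0 (w ++ [l]) = lambda0Step (lambda0 w) l := by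
    simp [lambda0]
  have h1 (l : Letter) : lambda1 (w ++ [l]) = lambda1Step (lambda1 w) l := by
    simp [lambda1]
  have hTT : ∀ y ∈ T, M.α y ∈ T := hT.2.1
  have hTc : ∀ y ∈ Tᶜ, M.α y ∈ Tᶜ := fun y hy h => hy ((M.α_mem_iff T hT y).mp h)
  have hnew (z : H) (hz : z ∈ M.heads T) (hzy : M.σ z = y) :
      (M.phi0 (M.heads T)).Sons (M.firstHead (M.heads T) y) [] y [] := by
    have := Sons.nil (M := M.phi0 (M.heads T)) (M.firstHead (M.heads T) y)
    rwa [← hzy, M.phi0_σ_firstHead _ hhd hz, hzy] at this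
  have hCmem : C ∈ C :: (L ++ R) := by simp
  -- a head met at the time `k + 1` is the head of the current vertex
  have hheads (D : List (StackEntry H)) (hD : ∀ z, (∃ p ∈ C :: (L ++ R),
      z ∈ M.firstHead (M.heads T) p.1 :: p.2.2) →
      ∃ p ∈ D, z ∈ M.firstHead (M.heads T) p.1 :: p.2.2) :
      ∀ z ∈ M.heads T, z ≠ M.root → (M.restrict T).time z ≤ k + 1 →
        ∃ p ∈ D, z ∈ M.firstHead (M.heads T) p.1 :: p.2.2 := by
    intro z hz hzr hzk
    apply hD
    rcases Nat.lt_or_ge k ((M.restrict T).time z) with h2 | h2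
    · have : z = x := (M.restrict T).time_inj hf (by omega)
      refine ⟨C, hCmem, ?_⟩
      rw [hCx, ← this, M.firstHead_of_mem _ hz]
      simp
    · exact h.heads z hz hzr h2
  by_cases hxT : x ∈ T
  · by_cases hlt : (M.restrict T).time x < (M.restrict T).time (M.α x)
    · have hl : M.tourLetter T k = .a := by
        simp only [tourLetter, Precedes, ← hx, hxT, hlt, if_true]
      have hxO : x ∉ M.heads T := (M.notMem_heads_iff T hM hT x).mpr (.inl ⟨hxT, hlt⟩)
      have hσ : M.σ (M.α x) = y := by rw [M.σ_α_of_mem T hT hxT, hxk]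
      -- All half-edges at the vertex entered through `x` lie in the segment of the border after
      -- `x`. So the vertex is new, and its label exceeds all former chain tops, which are at most
      -- `k + 1`.
      have hc : M.vertexTime T y = k + 1 + 1 := by
        refine le_antisymm (M.vertexTime_le T (.refl _ _)) ?_
        have h2 := M.sameCycle_mem_segment T hM hT hxT hlt le_rfl
          (z := (M.restrict T).border (M.vertexTime T y))
          ((Equiv.Perm.sameCycle_apply_left (f := M.σ)).mp
            (by rw [hσ]; exact M.sameCycle_border_vertexTime T hT y))
        have := (M.restrict T).time_border_le (M.vertexTime T y)
        omega
      obtain ⟨ts', hr, hp⟩ := StackEntry.reading_a h.reading (vertexTime_firstHead hT _ y)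
      rw [hc] at hp
      refine ⟨(y, [], []), L, C :: R, ts', ⟨rfl, h.left.skip hT hTc (by simpa using hxT) hxk, ?_,
        ?_, ?_, ?_, ?_, ?_, ?_, ?_⟩⟩
      · rw [List.map_cons, hCx]
        exact h.right.push hT hxT hxk (by omega)
      · intro p hp
        simp only [List.mem_cons, List.mem_append] at hp
        rcases hp with rfl | hp | rfl | hp
        · exact hnew _ (M.α_mem_heads T hM hT hxO) hσ
        · exact h.sons p (by simp [hp])
        · exact h.sons p (by simp)
        · exact h.sons p (by simp [hp])
      · rw [h0, hl, h.sequence, StackEntry.lambda0Step_a]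
      · rw [h1, hl]; exact hr
      · rw [hp.nodup_iff, List.nodup_cons]
        exact ⟨fun h2 => by have := h.le _ h2; omega, h.nodup⟩
      · intro v hv
        rw [hp.mem_iff, List.mem_cons] at hv
        rcases hv with rfl | hv
        · exact le_rfl
        · have := h.le v hv; omega
      · refine hheads _ ?_
        rintro z ⟨p, hp, hz⟩
        refine ⟨p, ?_, hz⟩
        simp only [List.mem_cons, List.mem_append] at hp ⊢
        tauto
      · have := h.length
        simp only [List.flatMap_cons, List.flatMap_append, List.length_append, List.length_cons,
          List.length_nil] at this ⊢
        omega
    · have hl : M.tourLetter T k = .abar := by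
        simp only [tourLetter, Precedes, ← hx, hxT, hlt, if_true, if_false]
      have hxO : x ∈ M.heads T := (M.mem_heads_iff T hM hT x).mpr (.inr (.inl ⟨hxT, by omega⟩))
      have hαO : M.α x ∉ M.heads T := M.α_notMem_heads T hM hT hxO hxr
      have hσ : M.σ (M.α x) = y := by rw [M.σ_α_of_mem T hT hxT, hxk]
      have hfh := M.firstHead_σ _ (hhd _) hαO
      rw [hσ] at hfh
      obtain ⟨R', hR', hop⟩ := h.right.pop hM hT hTT (fun y hy z hz => by simp [hy, hz]) hxT hxk
        (by omega)
      obtain ⟨p, R, rfl, hp1, rfl⟩ := List.map_eq_cons_iff.mp hR'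
      have hcp : M.vertexTime T p.1 = M.vertexTime T y := by
        rw [hp1, M.vertexTime_eq_iff T hT, ← hσ]
        exact Equiv.Perm.sameCycle_apply_right.mpr (.refl _ _)
      obtain ⟨ts', hr, hp⟩ := StackEntry.reading_abar h.reading hcp (by rw [hp1, hfh])
        (p.2.1 ++ [.node C.2.1])
      rw [hCx, M.firstHead_of_mem _ hxO] at hr
      refine ⟨(y, p.2.1 ++ [.node C.2.1], p.2.2 ++ x :: C.2.2), L, R, ts',
        ⟨rfl, h.left.skip hT hTc (by simpa using hxT) hxk, hop, ?_, ?_, ?_, ?_, ?_, ?_, ?_⟩⟩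
      · intro q hq
        simp only [List.mem_cons, List.mem_append] at hq
        rcases hq with rfl | hq | hq
        · have hsp := h.sons p (by simp)
          have hsC := h.sons C hCmem
          rw [hp1] at hsp
          rw [hCx, M.firstHead_of_mem _ hxO] at hsC
          -- The half-edge `α x` is a tail, so the turn around the vertex of `p` is not finished and
          -- can take another son.
          have hne : M.α x ≠ M.firstHead (M.heads T) (M.α x) := fun he =>
            hαO (by rw [he]; exact M.firstHead_mem _ (hhd _))
          have h3 := Sons.snoc hsp hne (us := C.2.1) (ls' := C.2.2) (by
            change (M.phi0 (M.heads T)).Sons (M.α (M.α x)) _ (M.α (M.α x)) _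
            rw [M.α_invol]; exact hsC)
          rw [M.phi0_σ_of_notMem _ (hhd _) hαO, hσ, ← hfh] at h3
          change (M.phi0 (M.heads T)).Sons _ _ _ (_ ++ M.α (M.α x) :: _) at h3
          rw [M.α_invol] at h3
          exact h3
        · exact h.sons q (by simp [hq])
        · exact h.sons q (by simp [hq])
      · rw [h0, hl, h.sequence, StackEntry.lambda0Step_abar]
      · rw [h1, hl]; exact hr
      · exact hp.nodup_iff.mpr h.nodup
      · intro v hv
        have := h.le v (hp.mem_iff.mp hv); omega
      · refine hheads _ ?_
        rintro z ⟨q, hq, hz⟩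
        simp only [List.mem_cons, List.mem_append] at hq
        rcases hq with rfl | hq | rfl | hq
        · rw [hCx, M.firstHead_of_mem _ hxO] at hz
          exact ⟨_, List.mem_cons_self, by simp at hz ⊢; tauto⟩
        · exact ⟨q, by simp [hq], hz⟩
        · rw [hp1, ← hfh] at hz
          exact ⟨_, List.mem_cons_self, by simp at hz ⊢; tauto⟩
        · exact ⟨q, by simp [hq], hz⟩
      · have := h.length
        simp only [List.flatMap_cons, List.flatMap_append, List.length_append, List.length_cons]
          at this ⊢
        omega
  · by_cases hlt : (M.restrict T).time x < (M.restrict T).time (M.α x)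
    · have hl : M.tourLetter T k = .b := by
        simp only [tourLetter, Precedes, ← hx, hxT, hlt, if_true, if_false]
      have hxO : x ∈ M.heads T := (M.mem_heads_iff T hM hT x).mpr (.inr (.inr ⟨hxT, hlt⟩))
      have hσ : M.σ x = y := by rw [M.σ_of_notMem T hT hxT, hxk]
      have hcC : M.vertexTime T C.1 = M.vertexTime T y := by
        rw [hCx, M.vertexTime_eq_iff T hT, ← hσ]
        exact Equiv.Perm.sameCycle_apply_right.mpr (.refl _ _)
      obtain ⟨ts', hr, hp⟩ := StackEntry.reading_b h.reading (vertexTime_firstHead hT _ y) hcC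
      refine ⟨(y, [], []), C :: L, R, ts', ⟨rfl, ?_, h.right.skip hT hTT hxT hxk, ?_, ?_, ?_, ?_,
        ?_, ?_, ?_⟩⟩
      · rw [List.map_cons, hCx]
        exact h.left.push hT hxT hxk (by omega)
      · intro p hp
        simp only [List.mem_cons, List.mem_append] at hp
        rcases hp with rfl | (rfl | hp) | hp
        · exact hnew _ hxO hσ
        · exact h.sons p (by simp)
        · exact h.sons p (by simp [hp])
        · exact h.sons p (by simp [hp])
      · rw [h0, hl, h.sequence, StackEntry.lambda0Step_b]
      · rw [h1, hl]; exact hr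
      · exact hp.nodup_iff.mpr h.nodup
      · intro v hv
        have := h.le v (hp.mem_iff.mp hv); omega
      · refine hheads _ ?_
        rintro z ⟨p, hp, hz⟩
        refine ⟨p, ?_, hz⟩
        simp only [List.mem_cons, List.mem_append] at hp ⊢
        tauto
      · have := h.length
        simp only [List.flatMap_cons, List.flatMap_append, List.length_append, List.length_cons,
          List.length_nil] at this ⊢
        omega
    · have hl : M.tourLetter T k = .bbar := by
        simp only [tourLetter, Precedes, ← hx, hxT, hlt, if_false]
      have hxO : x ∉ M.heads T :=
        (M.notMem_heads_iff T hM hT x).mpr (.inr ⟨hxT, hxr, by omega⟩)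
      have hαO : M.α x ∈ M.heads T := M.α_mem_heads T hM hT hxO
      have hσ : M.σ x = y := by rw [M.σ_of_notMem T hT hxT, hxk]
      have hfh := M.firstHead_σ _ (hhd _) hxO
      rw [hσ] at hfh
      obtain ⟨L', hL', hop⟩ := h.left.pop hM hT hTc
        (fun y hy z hz => iff_of_false hy hz) hxT hxk (by omega)
      obtain ⟨p, L, rfl, hp1, rfl⟩ := List.map_eq_cons_iff.mp hL'
      have hcC : M.vertexTime T C.1 = M.vertexTime T y := by
        rw [hCx, M.vertexTime_eq_iff T hT, ← hσ]
        exact Equiv.Perm.sameCycle_apply_right.mpr (.refl _ _)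
      obtain ⟨ts', hr, hp⟩ := StackEntry.reading_bbar h.reading hcC (by rw [hCx, hfh])
        (C.2.1 ++ [.node p.2.1])
      rw [hp1, M.firstHead_of_mem _ hαO] at hr
      refine ⟨(y, C.2.1 ++ [.node p.2.1], C.2.2 ++ M.α x :: p.2.2), L, R, ts',
        ⟨rfl, hop, h.right.skip hT hTT hxT hxk, ?_, ?_, ?_, ?_, ?_, ?_, ?_⟩⟩
      · intro q hq
        simp only [List.mem_cons, List.mem_append] at hq
        rcases hq with rfl | hq | hq
        · have hsp := h.sons p (by simp)
          have hsC := h.sons C hCmem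
          rw [hp1, M.firstHead_of_mem _ hαO] at hsp
          rw [hCx] at hsC
          have hne : x ≠ M.firstHead (M.heads T) x := fun he =>
            hxO (by rw [he]; exact M.firstHead_mem _ (hhd _))
          have h3 := Sons.snoc hsC hne (us := p.2.1) (ls' := p.2.2) hsp
          rw [M.phi0_σ_of_notMem _ (hhd _) hxO, hσ, ← hfh] at h3
          exact h3
        · exact h.sons q (by simp [hq])
        · exact h.sons q (by simp [hq])
      · rw [h0, hl, h.sequence, StackEntry.lambda0Step_bbar]
      · rw [h1, hl]; exact hr
      · exact hp.nodup_iff.mpr h.nodup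
      · intro v hv
        have := h.le v (hp.mem_iff.mp hv); omega
      · refine hheads _ ?_
        rintro z ⟨q, hq, hz⟩
        simp only [List.mem_cons, List.mem_append] at hq
        rcases hq with rfl | (rfl | hq) | hq
        · rw [hCx, ← hfh] at hz
          exact ⟨_, List.mem_cons_self, by simp at hz ⊢; tauto⟩
        · rw [hp1, M.firstHead_of_mem _ hαO] at hz
          exact ⟨_, List.mem_cons_self, by simp at hz ⊢; tauto⟩
        · exact ⟨q, by simp [hq], hz⟩
        · exact ⟨q, by simp [hq], hz⟩
      · have := h.length
        simp only [List.flatMap_cons, List.flatMap_append, List.length_append, List.length_cons]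
          at this ⊢
        omega

theorem exists_tourState (hM : M.IsRootedMap) (hT : M.IsSpanningTree T) (k : ℕ)
    (hk : k < Nat.card H) :
    ∃ C L R ts, M.IsTourState T k ((List.range k).map (M.tourLetter T)) C L R ts := by
  induction k with
  | zero => exact exists_tourState_zero hM hT
  | succ k ih =>
    obtain ⟨C, L, R, ts, h⟩ := ih (by omega)
    rw [List.range_succ, List.map_append]
    exact h.step hM hT hk

/-- The result of the tour: the tree of `λ₀` describes the vertex explosion, and the nodes of the tree
of `λ₁` correspond to its vertices. -/
theorem exists_sons_phi0 (hM : M.IsRootedMap) (hT : M.IsSpanningTree T) :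
    ∃ us ls, lambda0 (M.shuffle T) = [.u, .tree (.node us), .v] ∧
      (M.phi0 (M.heads T)).Sons M.root us M.root ls ∧
      ls.length = M.size ∧ (M.root :: ls).Nodup ∧ (∀ x ∈ M.root :: ls, x ∈ M.heads T) ∧
      ChainLabels none (lambda1' (M.shuffle T)) ((M.root :: ls).map (M.vertexTime T)) := by
  have hf := hT.2.2.2
  have hcard := M.card_eq T hM hT
  obtain ⟨C, L, R, ts, h⟩ := exists_tourState hM hT (2 * M.size) (by omega)
  rw [← M.shuffle_eq] at h
  -- The moment `2n` is the last one of the border, so no half-edge is still to come and both stacks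
  -- are empty.
  have hempty (S : Set H) (l : List H) (hl : M.IsOpenList T S (2 * M.size) l) : l = [] := by
    rw [List.eq_nil_iff_forall_not_mem]
    intro x hx
    have h1 := ((hl.2 x).mp hx).2.2
    have h2 := (M.restrict T).time_lt hf (M.α x)
    omega
  obtain rfl := List.map_eq_nil_iff.mp (hempty _ _ h.left)
  obtain rfl := List.map_eq_nil_iff.mp (hempty _ _ h.right)
  obtain ⟨x, us, ls⟩ := C
  obtain rfl : x = M.root := by
    have := h.current
    rw [← hcard, (M.restrict T).border_card hf] at this
    exact this
  have hroot : M.root ∈ M.heads T := .inl rfl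
  have hfr := M.firstHead_of_mem _ hroot
  have hs := h.sons (M.root, us, ls) (by simp)
  simp only [hfr] at hs
  have hlen := h.length
  simp only [List.append_nil, List.flatMap_cons, List.flatMap_nil, List.length_cons,
    List.length_nil, hfr] at hlen
  -- The list `M.root :: ls` has `n + 1` entries and contains all `n + 1` heads. Hence it has no
  -- repetition and no other elements.
  have hsub : M.heads T ⊆ {x | x ∈ M.root :: ls} := by
    intro x hx
    by_cases hxr : x = M.root
    · simp [hxr]
    · have h2 := (M.restrict T).time_lt hf x
      obtain ⟨p, hp, hxp⟩ := h.heads x hx hxr (by omega)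
      simp only [List.append_nil, List.mem_singleton] at hp
      rw [hp] at hxp
      simpa [hfr] using hxp
  classical
  have hset : {x | x ∈ M.root :: ls} = ((M.root :: ls).toFinset : Set H) := by
    ext; simp
  have hncard : ((M.root :: ls).toFinset : Set H).ncard = (M.root :: ls).toFinset.card :=
    Set.ncard_coe_finset _
  have hle := List.toFinset_card_le (M.root :: ls)
  have hheads := M.ncard_heads T hM hT
  rw [hset] at hsub
  have hle2 := Set.ncard_le_ncard hsub (Set.toFinite _)
  have hllen : (M.root :: ls).length = M.size + 1 := by simp only [List.length_cons]; omega
  have heq : M.heads T = ((M.root :: ls).toFinset : Set H) :=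
    Set.eq_of_subset_of_ncard_le hsub (by omega) (Set.toFinite _)
  refine ⟨us, ls, ?_, hs, by simpa using hllen, ?_, ?_, ?_⟩
  · rw [h.sequence]; rfl
  · rw [← Multiset.coe_nodup, ← Multiset.dedup_card_eq_card_iff_nodup]
    change (M.root :: ls).toFinset.card = (M.root :: ls).length
    omega
  · intro x hx
    rw [heq, ← hset]
    exact hx
  · have := (h.reading.chainLabels (by simpa using h.nodup)).1
    have hn : Visit.nodes (StackEntry.visits (M.firstHead (M.heads T)) (M.vertexTime T)
        (M.root, us, ls) [] []) = M.root :: ls := by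
      have h2 := Visit.nodes_map_node (V := ℕ) (M.root :: ls)
      simp only [StackEntry.visits, hfr, List.reverse_nil, List.flatMap_nil, List.nil_append]
      change Visit.nodes (_ ++ [Visit.left]) = _
      rw [Visit.nodes_append, h2]
      simp [Visit.nodes, Visit.node?]
    rw [hn] at this
    exact this

end HalfEdgeMap

/-! ### The order of appearance of the vertices -/

open Classical in
/-- The first occurrences in a list. -/
noncomputable def firstOccurrences {V : Type*} (l : List V) : List V := l.reverse.dedup.reverse

theorem firstOccurrences_concat_of_mem {V : Type*} {l : List V} {a : V} (h : a ∈ l) :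
    firstOccurrences (l ++ [a]) = firstOccurrences l := by
  classical
  simp [firstOccurrences, List.dedup_cons_of_mem, h]

theorem firstOccurrences_concat_of_notMem {V : Type*} {l : List V} {a : V} (h : a ∉ l) :
    firstOccurrences (l ++ [a]) = firstOccurrences l ++ [a] := by
  classical
  simp [firstOccurrences, List.dedup_cons_of_notMem, h]

theorem map_filter_range_eq_firstOccurrences {V : Type*} (f : ℕ → V) (p : ℕ → Bool)
    (hp : ∀ k, p k = true ↔ ∀ j < k, f j ≠ f k) (n : ℕ) :
    ((List.range n).filter p).map f = firstOccurrences ((List.range n).map f) := by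
  induction n with
  | zero => simp [firstOccurrences]
  | succ n ih =>
    rw [List.range_succ, List.filter_append, List.map_append, List.map_append, ih,
      List.map_singleton]
    by_cases h : f n ∈ (List.range n).map f
    · rw [firstOccurrences_concat_of_mem h, List.filter_singleton]
      have : p n = false := by
        rw [← Bool.not_eq_true, hp]
        simp only [List.mem_map, List.mem_range] at h
        obtain ⟨j, hj, h⟩ := h
        exact fun h' => h' j hj h
      simp [this]
    · rw [firstOccurrences_concat_of_notMem h, List.filter_singleton]
      have : p n = true := by
        rw [hp]
        intro j hj h'
        exact h (List.mem_map.mpr ⟨j, List.mem_range.mpr hj, h'⟩)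
      simp [this]

/-! ### Prefix order and the border of a plane tree -/

namespace HalfEdgeMap

variable {H : Type*} (M : HalfEdgeMap H)

/-- The vertex of a half-edge. -/
def vertex (x : H) : Quotient (Equiv.Perm.SameCycle.setoid M.σ) := Quotient.mk _ x

theorem vertex_eq_iff (x y : H) : M.vertex x = M.vertex y ↔ M.σ.SameCycle x y := Quotient.eq

theorem vertex_σ (x : H) : M.vertex (M.σ x) = M.vertex x :=
  (M.vertex_eq_iff _ _).mpr (Equiv.Perm.sameCycle_apply_left.mpr (.refl _ _))

/-- The vertices met at the first `n` moments along the border, starting at `x`. -/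
def verticesFrom (x : H) (n : ℕ) : List (Quotient (Equiv.Perm.SameCycle.setoid M.σ)) :=
  (List.range n).map fun k => M.vertex ((M.face ^ k) x)

theorem verticesFrom_add (x : H) (m n : ℕ) :
    M.verticesFrom x (m + n) = M.verticesFrom x m ++ M.verticesFrom ((M.face ^ m) x) n := by
  simp only [verticesFrom, List.range_add, List.map_append, List.map_map]
  congr 1
  refine List.map_congr_left fun k _ => ?_
  simp only [Function.comp_apply]
  rw [add_comm, pow_add, Equiv.Perm.mul_apply]

theorem verticesFrom_one (x : H) : M.verticesFrom x 1 = [M.vertex x] := rfl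

variable {M}

/-- The walk that starts after `h` passes the earlier sons, then goes around the last son, and
finally returns to the vertex of `h`. Each vertex of `ls` accounts for two steps, down and up the
edge to its father, and the additional `1` is that last visit. Every subtree consists of vertices
not seen before, so first occurrences come in prefix order. The list `l` stands for what was seen
before the walk. -/
theorem Sons.verticesFrom {h x : H} {ts : List PlaneTree} {ls : List H} (hs : M.Sons h ts x ls) :
    M.vertex x = M.vertex h ∧ (M.face ^ (2 * ls.length)) (M.σ h) = x ∧
      (∀ y ∈ M.verticesFrom (M.σ h) (2 * ls.length + 1), y ∈ M.vertex h :: ls.map M.vertex) ∧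
      ((M.vertex h :: ls.map M.vertex).Nodup → ∀ l, (ls.map M.vertex).Disjoint l →
        firstOccurrences (l ++ M.verticesFrom (M.σ h) (2 * ls.length + 1)) =
          firstOccurrences (l ++ [M.vertex h]) ++ ls.map M.vertex) := by
  induction hs with
  | nil h =>
    refine ⟨M.vertex_σ h, rfl, ?_, ?_⟩
    · intro y hy
      simpa [verticesFrom_one, vertex_σ] using hy
    · intro _ l _
      simp [verticesFrom_one, vertex_σ]
  | @snoc h x ts us ls ls' _ hne _ ih1 ih2 =>
    obtain ⟨hv, hf, hm, hn⟩ := ih1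
    obtain ⟨-, hf', hm', hn'⟩ := ih2
    have e1 : (M.face ^ (2 * ls.length + 1)) (M.σ h) = M.σ (M.α x) := by
      rw [pow_succ', Equiv.Perm.mul_apply, hf, face_apply]
    have e2 : (M.face ^ (2 * ls'.length + 1)) (M.σ (M.α x)) = M.σ x := by
      rw [pow_succ', Equiv.Perm.mul_apply, hf', face_apply, M.α_invol]
    have e3 : 2 * (ls ++ M.α x :: ls').length + 1 =
        (2 * ls.length + 1) + (2 * ls'.length + 1) + 1 := by
      simp only [List.length_append, List.length_cons]; omega
    have e4 : (M.face ^ (2 * ls.length + 1 + (2 * ls'.length + 1))) (M.σ h) = M.σ x := by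
      rw [add_comm, pow_add, Equiv.Perm.mul_apply, e1, e2]
    have e5 : M.verticesFrom (M.σ h) (2 * (ls ++ M.α x :: ls').length + 1) =
        M.verticesFrom (M.σ h) (2 * ls.length + 1) ++
          M.verticesFrom (M.σ (M.α x)) (2 * ls'.length + 1) ++ [M.vertex h] := by
      rw [e3, verticesFrom_add, verticesFrom_add, e1, e4, verticesFrom_one, vertex_σ, hv]
    refine ⟨by rw [vertex_σ, hv], ?_, ?_, ?_⟩
    · rw [← e4]
      congr 2
      omega
    · intro y hy
      rw [e5] at hy
      simp only [List.mem_append, List.mem_singleton] at hy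
      simp only [List.map_append, List.map_cons, List.mem_cons, List.mem_append]
      rcases hy with (hy | hy) | hy
      · have := List.mem_cons.mp (hm y hy); tauto
      · have := List.mem_cons.mp (hm' y hy); tauto
      · tauto
    · intro hnd l hl
      rw [List.map_append, List.map_cons] at hnd hl ⊢
      have hnd1 : (M.vertex h :: ls.map M.vertex).Nodup := by
        rw [← List.cons_append] at hnd
        exact (List.nodup_append'.mp hnd).1
      have hnd2 : (M.vertex (M.α x) :: ls'.map M.vertex).Nodup := by
        rw [← List.cons_append] at hnd
        exact (List.nodup_append'.mp hnd).2.1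
      have hd : (M.vertex h :: ls.map M.vertex).Disjoint
          (M.vertex (M.α x) :: ls'.map M.vertex) := by
        rw [← List.cons_append] at hnd
        exact (List.nodup_append'.mp hnd).2.2
      have hd' : (M.vertex (M.α x) :: ls'.map M.vertex).Disjoint
          (l ++ M.verticesFrom (M.σ h) (2 * ls.length + 1)) := by
        intro y hy hy'
        rcases List.mem_append.mp hy' with hy' | hy'
        · exact hl (List.mem_append_right _ hy) hy'
        · exact hd (hm y hy') hy
      have hmem : M.vertex h ∈ M.verticesFrom (M.σ h) (2 * ls.length + 1) := by
        rw [add_comm, verticesFrom_add, verticesFrom_one, vertex_σ]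
        simp
      rw [e5, ← List.append_assoc, firstOccurrences_concat_of_mem (by simp [hmem]),
        ← List.append_assoc, hn' hnd2 _ (List.disjoint_cons_left.mp hd').2,
        firstOccurrences_concat_of_notMem (List.disjoint_cons_left.mp hd').1,
        hn hnd1 l (List.disjoint_append_left.mp hl).1]
      simp

/-- The border from the root is one visit to the root followed by the walk of `Sons.verticesFrom`
without its last visit. That last visit is at the vertex of the root, already seen, so it does not
affect first occurrences. -/
theorem Sons.appearance [Finite H] {us : List PlaneTree} {ls : List H}
    (hs : M.Sons M.root us M.root ls) (hcard : Nat.card H = 2 * ls.length + 1)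
    (hnd : ((M.root :: ls).map M.vertex).Nodup) :
    M.appearance.map M.vertex = (M.root :: ls).map M.vertex := by
  classical
  obtain ⟨-, hf, hm, hn⟩ := hs.verticesFrom
  have h1 : M.appearance.map M.vertex =
      firstOccurrences (M.verticesFrom M.root (Nat.card H)) := by
    rw [HalfEdgeMap.appearance, List.map_map]
    refine map_filter_range_eq_firstOccurrences (fun k => M.vertex ((M.face ^ k) M.root)) _ ?_ _
    intro k
    simp only [decide_eq_true_eq, ne_eq, vertex_eq_iff]
  have h2 := hn hnd [M.vertex M.root] (by
    rw [List.disjoint_singleton]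
    exact (List.nodup_cons.mp hnd).1)
  rw [verticesFrom_add, hf, verticesFrom_one, ← List.append_assoc,
    firstOccurrences_concat_of_mem (by simp), firstOccurrences_concat_of_mem (by simp)] at h2
  rw [h1, hcard, add_comm, verticesFrom_add, verticesFrom_one, pow_one, face_apply, M.α_root, h2]
  simp [firstOccurrences]

end HalfEdgeMap

/-! ### The theorem -/

theorem mainTheorem4 {H : Type*} [Finite H] (M : HalfEdgeMap H) (T : Set H)
    (hM : M.IsRootedMap) (hT : M.IsSpanningTree T) :
    -- the tree `φ₀` of the oriented map is the tree of the tree-sequence `λ₀(w) = u T v`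
    (∃ t : PlaneTree, lambda0 (M.shuffle T) = [.u, .tree t, .v] ∧
      (M.phi0 (M.heads T)).IsTree t) ∧
    -- the partition `φ₁` of the oriented map is `Θ(λ₁'(w))`
    ((lambda1' (M.shuffle T)).size = M.size + 1 ∧
      IsTheta (lambda1' (M.shuffle T)) (M.phi1 (M.heads T))) ∧
    -- `Θ` is a well-defined bijection from binary trees to non-crossing partitions of each size
    (∀ m : ℕ,
      (∀ B : BinTree Unit, B.size = m → ∃! P : Setoid (Fin m), IsTheta B P) ∧
      (∀ P : Setoid (Fin m), IsNonCrossing P → ∃! B : BinTree Unit, B.size = m ∧ IsTheta B P)) := by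
  obtain ⟨us, ls, hseq, hs, hlen, hnd, hheads, hB⟩ := HalfEdgeMap.exists_sons_phi0 hM hT
  refine ⟨⟨.node us, hseq, M.phi0_connected T hM hT, hs.describes⟩, ⟨?_, ?_⟩, fun m => ⟨?_, ?_⟩⟩
  · rw [hB.size_eq, List.length_map, List.length_cons, hlen]
  -- The first head is constant on an exploded vertex and fixes every head, so different heads lie
  -- on different exploded vertices.
  · have hnd' : ((M.root :: ls).map (M.phi0 (M.heads T)).vertex).Nodup := by
      refine hnd.map_on fun x hx y hy hxy => ?_
      have := M.firstHead_eq_of_sameCycle _ ((HalfEdgeMap.vertex_eq_iff _ _ _).mp hxy)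
      rwa [M.firstHead_of_mem _ (hheads x hx), M.firstHead_of_mem _ (hheads y hy)] at this
    have happ := HalfEdgeMap.Sons.appearance (M := M.phi0 (M.heads T)) hs
      (by rw [M.card_eq T hM hT, hlen]) hnd'
    have hl : (M.phi0 (M.heads T)).appearance.length = (M.root :: ls).length := by
      simpa using congrArg List.length happ
    refine hB.isTheta (by simp [hlen]) fun i j => ?_
    -- The vertex that appears at rank `i` and the head of rank `i` in prefix order belong to the
    -- same exploded vertex, hence to the same vertex of `M`. So the chain labels of `λ₁'(w)` name
    -- the classes of `φ₁`.
    have hi : ∀ i : Fin (M.size + 1), M.vertexTime T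
        ((M.phi0 (M.heads T)).appearance.getD i.val M.root) =
          ((M.root :: ls).map (M.vertexTime T))[i]'(by
            have := i.2; simp only [List.length_map, List.length_cons]; omega) := by
      intro i
      have h1 : i.val < (M.root :: ls).length := by
        have := i.2; simp only [List.length_cons]; omega
      have h2 : ((M.phi0 (M.heads T)).appearance.map (M.phi0 (M.heads T)).vertex)[i.val]'(by
          rw [List.length_map, hl]; exact h1) =
          ((M.root :: ls).map (M.phi0 (M.heads T)).vertex)[i.val]'(by simpa using h1) := by
        simp only [happ]
        rfl
      rw [List.getElem_map, List.getElem_map, HalfEdgeMap.vertex_eq_iff] at h2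
      rw [List.getD_eq_getElem _ _ (by rw [hl]; exact h1), Fin.getElem_fin, List.getElem_map,
        M.vertexTime_eq_iff T hT]
      exact M.sameCycle_of_phi0 _ h2
    rw [← hi, ← hi, M.vertexTime_eq_iff T hT]
    rfl
  · intro B hB
    obtain ⟨P, hP⟩ := BinTree.exists_isTheta hB
    exact ⟨P, hP, fun P' hP' => hP'.partition_unique hP⟩
  · intro P hP
    obtain ⟨B, hB, hBP⟩ := hP.exists_isTheta
    exact ⟨B, ⟨hB, hBP⟩, fun B' hB' => hB'.2.binTree_unique hBP⟩
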